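/- Let $S$ be a closed orientable surface of genus at least $2$ with a hyperbolic metric, so that $S=\mathbb H^2/\Gamma$, where $\Gamma\cong\pi_1(S)$ is a subgroup of $\mathrm{PSL}(2,\mathbb R)$ acting freely, properly discontinuously and cocompactly on $\tilde S=\mathbb H^2$. Let $\mathcal G$ be the space of unordered pairs of distinct points of the circle at infinity, identified with the space of complete geodesics of $\mathbb H^2$. A geodesic current is a locally finite $\Gamma$-invariant Borel measure on $\mathcal G$; it is filling if every complete geodesic of $\mathbb H^2$ transversely intersects a geodesic in its support. A curve on $S$ is the conjugacy class of a nontrivial primitive element $\gamma\in\Gamma$; it is identified with the current given by the counting measure on the set of axes of the conjugates of $\gamma$. The intersection number $i(\mu,\nu)$ of two currents is the total mass of the measure induced by $\mu\times\nu$ on the quotient by $\Gamma$ of the set of pairs of transversely intersecting geodesics. Let $\nu$ be a filling current, and for $x,y\in\mathbb H^2$ let $$d'(x,y)=\nu\bigl(\{\text{geodesics that intersect the closed geodesic arc }[x,y]\text{ transversely}\}\bigr),\qquad d'(x,x)=0 .$$ Then there is a metric space $(X,d)$ on which $\Gamma=\pi_1(S)$ acts by isometries, discretely (for all $x\in X$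 and $r\in\mathbb R$, only finitely many $\gamma\in\Gamma$ satisfy $d(x,\gamma x)\le r$) and cocompactly (the translates of some compact set cover $X$), such that for every curve $\gamma$ on $S$ the number $i(\nu,\gamma)$ is finite and $$sl_X(\gamma)=\lim_{n\to\infty}\frac1n\inf_{x\in X}d(x,\gamma^n x)=i(\nu,\gamma).$$ Moreover, $X$ can be chosen together with a $\Gamma$-equivariant map $\pi:\mathbb H^2\to X$ with dense image such that $d(\pi(x),\pi(y))=d'(x,y)$ for all $x,y\in\mathbb H^2$; that is, $d'$ is a finite semi-distance, and $X$ contains the quotient of $\mathbb H^2$ by the relation $d'(x,y)=0$, with the induced metric, as a dense $\Gamma$-invariant subset. -/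

import Mathlib

open MeasureTheory Filter Topology UpperHalfPlane
open scoped MatrixGroups ENNReal

noncomputable section

namespace Currents

/-! ### The action of `PSL(2,ℝ) = Isom⁺(ℍ)` on the hyperbolic plane and on its boundary circle -/

/-- The circle at infinity of the upper half-plane, `ℝ ∪ {∞}`. -/
abbrev Boundary : Type := OnePoint ℝ

theorem center_entries {A : SL(2, ℝ)} (hA : A ∈ Subgroup.center SL(2, ℝ)) :
    A 0 1 = 0 ∧ A 1 0 = 0 ∧ A 0 0 = A 1 1 ∧ A 1 1 ≠ 0 := by
  have h := Matrix.SpecialLinearGroup.scalar_eq_self_of_mem_center hA 1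
  have h01 := congrFun (congrFun h 0) 1
  have h10 := congrFun (congrFun h 1) 0
  have h00 := congrFun (congrFun h 0) 0
  have hd := A.det_coe
  rw [Matrix.det_fin_two] at hd
  simp at h01 h10 h00
  refine ⟨h01.symm, h10.symm, h00.symm, fun h1 => ?_⟩
  rw [← h01, h1] at hd
  simp at hd

/-- The action of `PSL(2,ℝ)` on `ℍ` by Möbius transformations. -/
def planeHom : PSL(2, ℝ) →* Equiv.Perm ℍ :=
  QuotientGroup.lift (Subgroup.center SL(2, ℝ)) (MulAction.toPermHom SL(2, ℝ) ℍ) (by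
    intro A hA
    obtain ⟨h01, h10, h00, h11⟩ := center_entries hA
    ext z
    have h11' : ((A 1 1 : ℝ) : ℂ) ≠ 0 := by exact_mod_cast h11
    simp [UpperHalfPlane.coe_specialLinearGroup_apply, h01, h10, h00, h11'])

/-- The action of `PSL(2,ℝ)` on the circle at infinity by Möbius transformations. -/
def boundaryHom : PSL(2, ℝ) →* Equiv.Perm Boundary :=
  QuotientGroup.lift (Subgroup.center SL(2, ℝ))
    ((MulAction.toPermHom (GL (Fin 2) ℝ) Boundary).comp Matrix.SpecialLinearGroup.toGL) (by
    intro A hA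
    obtain ⟨h01, h10, h00, h11⟩ := center_entries hA
    ext p
    induction p using OnePoint.rec with
    | infty => simp [OnePoint.smul_infty_eq_ite, h10]
    | coe t => simp [OnePoint.smul_some_eq_ite, h01, h10, h00, h11])

instance : MulAction PSL(2, ℝ) ℍ := MulAction.compHom ℍ planeHom

instance : MulAction PSL(2, ℝ) Boundary := MulAction.compHom Boundary boundaryHom

/-! ### Closed hyperbolic surfaces -/

/-- `Γ` is the group of deck transformations of the universal covering `ℍ → S` of a closed
oriented hyperbolic surface `S = ℍ / Γ` (whose genus is then at least two): it acts freely and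
properly discontinuously on `ℍ`, with compact quotient. As a group, `Γ` is `π₁(S)`. -/
structure IsClosedSurfaceGroup (Γ : Subgroup PSL(2, ℝ)) : Prop where
  free : ∀ (γ : Γ) (z : ℍ), γ • z = z → γ = 1
  properlyDiscontinuous : ProperlyDiscontinuousSMul Γ ℍ
  compact_quotient : CompactSpace (Quotient (MulAction.orbitRel Γ ℍ))

/-- A curve on `S = ℍ / Γ`, given by an element of its conjugacy class in `Γ = π₁(S)`:
it is essential (nontrivial) and primitive (not a proper power). -/
def IsCurve {Γ : Subgroup PSL(2, ℝ)} (γ : Γ) : Prop :=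
  γ ≠ 1 ∧ ∀ (η : Γ) (k : ℕ), 1 < k → γ ≠ η ^ k

/-! ### The space of geodesics -/

/-- The space of geodesics of `ℍ`: unordered pairs of distinct points of the circle at infinity. -/
def Geod : Type := {s : Sym2 Boundary // ¬ s.IsDiag}

/-- The geodesic with two given distinct endpoints. -/
def Geod.mk (p : {p : Boundary × Boundary // p.1 ≠ p.2}) : Geod :=
  ⟨s(p.1.1, p.1.2), fun h => p.2 (Sym2.mk_isDiag_iff.mp h)⟩

/-- The quotient topology. -/
instance : TopologicalSpace Geod := TopologicalSpace.coinduced Geod.mk inferInstance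

instance : MeasurableSpace Geod := borel Geod

instance : BorelSpace Geod := ⟨rfl⟩

/-- The action on unordered pairs of endpoints. -/
instance : MulAction PSL(2, ℝ) Geod where
  smul γ g := ⟨g.1.map (γ • ·), fun h => g.2
    ((Sym2.isDiag_map (MulAction.injective γ)).mp h)⟩
  one_smul g := Subtype.ext (by
    change Sym2.map (fun p : Boundary => (1 : PSL(2, ℝ)) • p) g.1 = g.1
    simp)
  mul_smul γ δ g := Subtype.ext (by
    change Sym2.map (fun p : Boundary => (γ * δ) • p) g.1 =
      Sym2.map (fun p : Boundary => γ • p) (Sym2.map (fun p : Boundary => δ • p) g.1)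
    rw [Sym2.map_map]
    congr 1
    funext p
    exact mul_smul γ δ p)

/-- The equation of the complete geodesic of `ℍ` with endpoints `a` and `b`: the half-circle
with diameter from `a` to `b`, or a vertical line if one endpoint is `∞`. -/
def endpointForm (z : ℍ) : Boundary → Boundary → ℝ
  | some a, some b => (z.re - a) * (z.re - b) + z.im ^ 2
  | some a, none => z.re - a
  | none, some b => z.re - b
  | none, none => 1

theorem endpointForm_comm (z : ℍ) (a b : Boundary) :
    endpointForm z a b = endpointForm z b a := by
  rcases a with _ | a <;> rcases b with _ | b <;> simp only [endpointForm]
  ring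

/-- The set of points of `ℍ` on a geodesic. -/
def Geod.carrier (g : Geod) : Set ℍ :=
  {z | Sym2.lift ⟨endpointForm z, endpointForm_comm z⟩ g.1 = 0}

/-- Two geodesics intersect transversely: they are distinct and have a common point. -/
def Transverse (g h : Geod) : Prop :=
  g ≠ h ∧ (g.carrier ∩ h.carrier).Nonempty

/-- The hyperbolic geodesic arc from `x` to `y`, endpoints included. -/
def arc (x y : ℍ) : Set ℍ := {z | dist x z + dist z y = dist x y}

/-- The geodesics that intersect the arc from `x` to `y` transversely: they meet it and do not
contain it. This is the empty set if `x = y`. -/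
def crossing (x y : ℍ) : Set Geod :=
  {g | (g.carrier ∩ arc x y).Nonempty ∧ ¬ arc x y ⊆ g.carrier}

/-! ### Geodesic currents -/

/-- A geodesic current on `S = ℍ / Γ`: a locally finite `Γ`-invariant Borel measure on the space
of geodesics. -/
structure IsCurrent (Γ : Subgroup PSL(2, ℝ)) (ν : Measure Geod) : Prop where
  locallyFinite : IsLocallyFiniteMeasure ν
  invariant : SMulInvariantMeasure Γ Geod ν

/-- Every complete geodesic transversely intersects a geodesic in the support of `ν`. -/
def IsFilling (ν : Measure Geod) : Prop :=
  ∀ g : Geod, ∃ h ∈ ν.support, Transverse g h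

/-- The lifts to `ℍ` of the closed geodesic in the class of `γ`: the axes of the conjugates of
`γ`, that is, the geodesics invariant under some conjugate of `γ`. -/
def lifts {Γ : Subgroup PSL(2, ℝ)} (γ : Γ) : Set Geod :=
  {g | ∃ δ : Γ, (δ * γ * δ⁻¹) • g = g}

/-- The current of a curve: the counting measure on the set of its lifts. -/
def curveCurrent {Γ : Subgroup PSL(2, ℝ)} (γ : Γ) : Measure Geod :=
  Measure.count.restrict (lifts γ)

/-- The intersection form: the total mass of the measure induced by `μ × ν` on the quotient by the
diagonal action of `Γ` of the set of transversely intersecting pairs of geodesics, that is, the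
`μ × ν`-mass of a fundamental domain of this set. -/
def intersection (Γ : Subgroup PSL(2, ℝ)) (μ ν : Measure Geod) : ℝ≥0∞ :=
  covolume Γ (Geod × Geod) ((μ.prod ν).restrict {p | Transverse p.1 p.2})

/-! ### Isometric actions -/

/-- Only finitely many group elements move a given point a bounded distance. -/
def ActsDiscretely (G X : Type) [Group G] [MetricSpace X] [MulAction G X] : Prop :=
  ∀ (x : X) (r : ℝ), {g : G | dist x (g • x) ≤ r}.Finite

/-- The translates of some compact set cover `X`. -/
def ActsCocompactly (G X : Type) [Group G] [MetricSpace X] [MulAction G X] : Prop :=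
  ∃ K : Set X, IsCompact K ∧ ∀ x : X, ∃ g : G, g • x ∈ K

/-- The translation length `inf_x d(x, g x)`. -/
def translationLength {G : Type} (X : Type) [Group G] [MetricSpace X] [MulAction G X] (g : G) :
    ℝ :=
  ⨅ x : X, dist x (g • x)

/-- The limit defining the stable length of `g` exists and is equal to `ℓ`. -/
def HasStableLength {G : Type} (X : Type) [Group G] [MetricSpace X] [MulAction G X] (g : G)
    (ℓ : ℝ) : Prop :=
  Tendsto (fun n : ℕ => (1 / (n : ℝ)) * translationLength X (g ^ n)) atTop (𝓝 ℓ)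

end Currents

end

noncomputable section

namespace Currents

/-! ### Symmetric matrices -/

/-- Symmetric `2 × 2` matrices, with entries `(A, B, C)`. -/
abbrev SymMat : Type := ℝ × ℝ × ℝ

/-- The polarization of the determinant. -/
def SymMat.pair (X Y : SymMat) : ℝ := (X.1 * Y.2.2 + X.2.2 * Y.1) / 2 - X.2.1 * Y.2.1

/-- The determinant one positive definite matrix corresponding to a point of `ℍ`. -/
def planePt (z : ℍ) : SymMat := ((z.re ^ 2 + z.im ^ 2) / z.im, z.re / z.im, 1 / z.im)

theorem pair_planePt (z w : ℍ) : SymMat.pair (planePt z) (planePt w) = Real.cosh (dist z w) := by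
  have hz := z.im_ne_zero
  have hw := w.im_ne_zero
  rw [UpperHalfPlane.cosh_dist', SymMat.pair, planePt, planePt]
  field_simp
  ring

theorem planePt_det (z : ℍ) : (planePt z).1 * (planePt z).2.2 = 1 + (planePt z).2.1 ^ 2 := by
  have hz := z.im_ne_zero
  simp only [planePt]
  field_simp
  ring

theorem planePt_fst_pos (z : ℍ) : 0 < (planePt z).1 := by
  have := z.im_pos
  simp only [planePt]
  positivity

theorem planePt_snd_pos (z : ℍ) : 0 < (planePt z).2.2 := by
  have := z.im_pos
  simp only [planePt]
  positivity

theorem continuous_planePt : Continuous planePt := by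
  unfold planePt
  have h : ∀ z : ℍ, z.im ≠ 0 := fun z => z.im_ne_zero
  have h1 := UpperHalfPlane.continuous_re
  have h2 := UpperHalfPlane.continuous_im
  fun_prop (disch := assumption)

/-- Every positive definite symmetric matrix is a multiple of a matrix from `ℍ`. -/
theorem exists_planePt {X : SymMat} (hC : 0 < X.2.2) (hdet : 0 < X.1 * X.2.2 - X.2.1 ^ 2) :
    ∃ z : ℍ, Real.sqrt (X.1 * X.2.2 - X.2.1 ^ 2) • planePt z = X := by
  obtain ⟨A, B, C⟩ := X
  simp only at hC hdet ⊢
  set N := Real.sqrt (A * C - B ^ 2) with hN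
  have hN0 : 0 < N := Real.sqrt_pos.mpr hdet
  have hN2 : N ^ 2 = A * C - B ^ 2 := Real.sq_sqrt hdet.le
  refine ⟨⟨⟨B / C, N / C⟩, by simpa using div_pos hN0 hC⟩, ?_⟩
  simp only [planePt, Prod.smul_mk, smul_eq_mul, Prod.mk.injEq]
  refine ⟨?_, ?_, ?_⟩
  · simp only [UpperHalfPlane.re, UpperHalfPlane.im]
    field_simp
    rw [hN2]; ring
  · simp only [UpperHalfPlane.re, UpperHalfPlane.im]
    field_simp
  · simp only [UpperHalfPlane.im]
    field_simp

theorem planePt_injective : Function.Injective planePt := by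
  intro z w h
  simp only [planePt, Prod.mk.injEq] at h
  have hz := z.im_ne_zero
  have hw := w.im_ne_zero
  obtain ⟨-, h2, h3⟩ := h
  have him : z.im = w.im := by field_simp at h3; exact h3.symm
  rw [him] at h2
  have hre : z.re = w.re := by field_simp at h2; exact h2
  exact UpperHalfPlane.ext (Complex.ext hre him)

/-- A null vector orthogonal to a positive definite matrix vanishes. -/
theorem eq_zero_of_pair_planePt {z : ℍ} {W : SymMat} (h0 : W.1 * W.2.2 = W.2.1 ^ 2)
    (h1 : SymMat.pair (planePt z) W = 0) : W = 0 := by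
  have hd := planePt_det z
  have hA := planePt_fst_pos z
  have hC := planePt_snd_pos z
  simp only [SymMat.pair] at h1
  set A := (planePt z).1
  set B := (planePt z).2.1
  set C := (planePt z).2.2
  obtain ⟨a, b, c⟩ := W
  simp only at h0 h1
  have hs : A * c + C * a = 2 * B * b := by linarith
  have hb : b = 0 := by
    have h2 : (A * c) * (C * a) = (1 + B ^ 2) * b ^ 2 := by rw [← hd, ← h0]; ring
    have h3 : 4 * ((A * c) * (C * a)) ≤ (A * c + C * a) ^ 2 := by
      nlinarith [sq_nonneg (A * c - C * a)]
    rw [hs, h2] at h3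
    have : b ^ 2 ≤ 0 := by nlinarith
    exact pow_eq_zero_iff (two_ne_zero) |>.mp (le_antisymm this (sq_nonneg b))
  subst hb
  have hac : a = 0 ∨ c = 0 := by
    rcases mul_eq_zero.mp (show a * c = 0 by nlinarith) with h | h <;> simp [h]
  have : a = 0 ∧ c = 0 := by
    rcases hac with h | h
    · subst h
      refine ⟨rfl, ?_⟩
      have : A * c = 0 := by linarith
      exact (mul_eq_zero.mp this).resolve_left hA.ne'
    · subst h
      refine ⟨?_, rfl⟩
      have : C * a = 0 := by linarith
      exact (mul_eq_zero.mp this).resolve_left hC.ne'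
  simp [this.1, this.2]

theorem exists_planePt_eq_of_mem_arc {x y z : ℍ} (hz : z ∈ arc x y) :
    ∃ s t : ℝ, 0 ≤ s ∧ 0 ≤ t ∧ 0 < s + t ∧ planePt z = s • planePt x + t • planePt y := by
  rcases eq_or_ne x y with rfl | hxy
  · have hz' : dist x z + dist z x = dist x x := hz
    rw [dist_self, dist_comm z x] at hz'
    have : x = z := dist_eq_zero.mp (by linarith [dist_nonneg (x := x) (y := z)])
    subst this
    exact ⟨1, 0, by simp⟩
  have hd : 0 < dist x y := dist_pos.mpr hxy
  have hz' : dist x z + dist z y = dist x y := hz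
  set d1 := dist x z with hd1
  set d2 := dist z y with hd2
  have hsd : 0 < Real.sinh (dist x y) := Real.sinh_pos_iff.mpr hd
  have h1 : 0 ≤ Real.sinh d1 := Real.sinh_nonneg_iff.mpr dist_nonneg
  have h2 : 0 ≤ Real.sinh d2 := Real.sinh_nonneg_iff.mpr dist_nonneg
  have key : Real.sinh d2 • planePt x + Real.sinh d1 • planePt y
      - Real.sinh (d1 + d2) • planePt z = 0 := by
    have pxx := pair_planePt x x
    have pyy := pair_planePt y y
    have pzz := pair_planePt z z
    have pxy := pair_planePt x y
    have pxz := pair_planePt x z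
    have pzy := pair_planePt z y
    rw [dist_self, Real.cosh_zero] at pxx pyy pzz
    rw [← hz', Real.cosh_add] at pxy
    rw [← hd1] at pxz
    rw [← hd2] at pzy
    have c1 := Real.cosh_sq d1
    have c2 := Real.cosh_sq d2
    simp only [SymMat.pair] at pxx pyy pzz pxy pxz pzy
    refine eq_zero_of_pair_planePt (z := z) ?_ ?_
    · rw [Real.sinh_add]
      simp only [Prod.fst_add, Prod.snd_add, Prod.smul_fst, Prod.smul_snd, smul_eq_mul,
        Prod.fst_sub, Prod.snd_sub]
      have : ∀ S1 C1 S2 C2 A B C A' B' C' A'' B'' C'' : ℝ, C1 ^ 2 = S1 ^ 2 + 1 →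
          C2 ^ 2 = S2 ^ 2 + 1 → (A * C + C * A) / 2 - B * B = 1 →
          (A' * C' + C' * A') / 2 - B' * B' = 1 → (A'' * C'' + C'' * A'') / 2 - B'' * B'' = 1 →
          (A * C' + C * A') / 2 - B * B' = C1 * C2 + S1 * S2 →
          (A * C'' + C * A'') / 2 - B * B'' = C1 → (A'' * C' + C'' * A') / 2 - B'' * B' = C2 →
          (S2 * A + S1 * A' - (S1 * C2 + C1 * S2) * A'') *
            (S2 * C + S1 * C' - (S1 * C2 + C1 * S2) * C'') =
          (S2 * B + S1 * B' - (S1 * C2 + C1 * S2) * B'') ^ 2 := by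
        intro S1 C1 S2 C2 A B C A' B' C' A'' B'' C'' e1 e2 a b c d e f
        linear_combination S2 ^ 2 * a + S1 ^ 2 * b + (S1 * C2 + C1 * S2) ^ 2 * c
          + 2 * S1 * S2 * d - 2 * S2 * (S1 * C2 + C1 * S2) * e
          - 2 * S1 * (S1 * C2 + C1 * S2) * f - S2 ^ 2 * e1 - S1 ^ 2 * e2
      exact this _ _ _ _ _ _ _ _ _ _ _ _ _ c1 c2 pxx pyy pzz pxy pxz pzy
    · rw [Real.sinh_add]
      simp only [SymMat.pair, Prod.fst_add, Prod.snd_add, Prod.smul_fst, Prod.smul_snd,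
        smul_eq_mul, Prod.fst_sub, Prod.snd_sub]
      linear_combination Real.sinh d2 * pxz + Real.sinh d1 * pzy
        - (Real.sinh d1 * Real.cosh d2 + Real.cosh d1 * Real.sinh d2) * pzz
  rw [hz'] at key
  have hpos : 0 < Real.sinh d1 + Real.sinh d2 := by
    rcases (dist_nonneg (x := x) (y := z)).lt_or_eq with h | h
    · have := Real.sinh_pos_iff.mpr h
      linarith
    · have : 0 < d2 := by linarith
      have := Real.sinh_pos_iff.mpr this
      linarith
  refine ⟨Real.sinh d2 / Real.sinh (dist x y), Real.sinh d1 / Real.sinh (dist x y),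
    by positivity, by positivity, ?_, ?_⟩
  · rw [← add_div]
    exact div_pos (by linarith) hsd
  · have h3 := sub_eq_zero.mp key
    have h4 : planePt z = (Real.sinh (dist x y))⁻¹ • (Real.sinh (dist x y) • planePt z) := by
      rw [smul_smul, inv_mul_cancel₀ hsd.ne', one_smul]
    rw [h4, ← h3, smul_add, smul_smul, smul_smul, div_eq_inv_mul, div_eq_inv_mul]

theorem exists_mem_arc_of_combination {x y : ℍ} {s t : ℝ} (hs : 0 ≤ s) (ht : 0 ≤ t)
    (hst : 0 < s + t) :
    ∃ z ∈ arc x y, ∃ k : ℝ, 0 < k ∧ k • planePt z = s • planePt x + t • planePt y := by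
  have pxx := pair_planePt x x
  have pyy := pair_planePt y y
  have pxy := pair_planePt x y
  rw [dist_self, Real.cosh_zero] at pxx pyy
  have hc : 1 ≤ Real.cosh (dist x y) := Real.one_le_cosh _
  set X := s • planePt x + t • planePt y with hX
  have hC : 0 < X.2.2 := by
    simp only [hX, Prod.snd_add, Prod.smul_snd, smul_eq_mul]
    have h1 := planePt_snd_pos x
    have h2 := planePt_snd_pos y
    rcases hs.lt_or_eq with h | h
    · positivity
    · have : 0 < t := by linarith
      positivity
  have hdet : X.1 * X.2.2 - X.2.1 ^ 2 = s ^ 2 + t ^ 2 + 2 * s * t * Real.cosh (dist x y) := by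
    simp only [hX, Prod.snd_add, Prod.fst_add, Prod.smul_snd, Prod.smul_fst, smul_eq_mul]
    simp only [SymMat.pair] at pxx pyy pxy
    linear_combination s ^ 2 * pxx + t ^ 2 * pyy + 2 * s * t * pxy
  have hpos : 0 < X.1 * X.2.2 - X.2.1 ^ 2 := by
    rw [hdet]
    have : 0 ≤ s * t := by positivity
    nlinarith
  obtain ⟨z, hz⟩ := exists_planePt hC hpos
  set N := Real.sqrt (X.1 * X.2.2 - X.2.1 ^ 2) with hN
  have hN0 : 0 < N := Real.sqrt_pos.mpr hpos
  have hN2 : N ^ 2 = s ^ 2 + t ^ 2 + 2 * s * t * Real.cosh (dist x y) := by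
    rw [hN, Real.sq_sqrt hpos.le, hdet]
  refine ⟨z, ?_, N, hN0, hz⟩
  have hzz : planePt z = N⁻¹ • X := by rw [← hz, smul_smul, inv_mul_cancel₀ hN0.ne', one_smul]
  have hxz : Real.cosh (dist x z) = (s + t * Real.cosh (dist x y)) / N := by
    rw [← pair_planePt, hzz, eq_div_iff hN0.ne']
    simp only [SymMat.pair, hX, Prod.snd_add, Prod.fst_add, Prod.smul_snd, Prod.smul_fst,
      smul_eq_mul]
    simp only [SymMat.pair] at pxx pyy pxy
    field_simp
    linear_combination 2 * s * pxx + 2 * t * pxy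
  have hzy : Real.cosh (dist z y) = (t + s * Real.cosh (dist x y)) / N := by
    rw [← pair_planePt, hzz, eq_div_iff hN0.ne']
    simp only [SymMat.pair, hX, Prod.snd_add, Prod.fst_add, Prod.smul_snd, Prod.smul_fst,
      smul_eq_mul]
    simp only [SymMat.pair] at pxx pyy pxy
    field_simp
    linear_combination 2 * t * pyy + 2 * s * pxy
  have hsd : 0 ≤ Real.sinh (dist x y) := Real.sinh_nonneg_iff.mpr dist_nonneg
  have hcs := Real.cosh_sq (dist x y)
  have hsxz : Real.sinh (dist x z) = t * Real.sinh (dist x y) / N := by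
    rw [← abs_of_nonneg (Real.sinh_nonneg_iff.mpr (dist_nonneg (x := x) (y := z))),
      ← abs_of_nonneg (show 0 ≤ t * Real.sinh (dist x y) / N by positivity), ← sq_eq_sq_iff_abs_eq_abs,
      Real.sinh_sq, hxz]
    field_simp
    rw [hN2]
    linear_combination t ^ 2 * hcs
  have hszy : Real.sinh (dist z y) = s * Real.sinh (dist x y) / N := by
    rw [← abs_of_nonneg (Real.sinh_nonneg_iff.mpr (dist_nonneg (x := z) (y := y))),
      ← abs_of_nonneg (show 0 ≤ s * Real.sinh (dist x y) / N by positivity), ← sq_eq_sq_iff_abs_eq_abs,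
      Real.sinh_sq, hzy]
    field_simp
    rw [hN2]
    linear_combination s ^ 2 * hcs
  have hcosh : Real.cosh (dist x z + dist z y) = Real.cosh (dist x y) := by
    rw [Real.cosh_add, hxz, hzy, hsxz, hszy]
    field_simp
    rw [hN2]
    linear_combination (-s * t) * hcs
  have h := le_antisymm (Real.cosh_le_cosh.mp hcosh.le) (Real.cosh_le_cosh.mp hcosh.ge)
  rwa [abs_of_nonneg (add_nonneg dist_nonneg dist_nonneg), abs_of_nonneg dist_nonneg] at h

/-! ### Geodesics as linear forms -/

/-- Homogeneous coordinates of a boundary point. -/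
def rep : Boundary → ℝ × ℝ
  | some a => (a, 1)
  | none => (1, 0)

/-- The squared norm of the homogeneous coordinates. -/
def repNorm (a : Boundary) : ℝ := (rep a).1 ^ 2 + (rep a).2 ^ 2

theorem repNorm_pos (a : Boundary) : 0 < repNorm a := by
  rcases a with _ | a <;> simp only [repNorm, rep] <;> positivity

/-- The rank one matrix of trace one corresponding to a boundary point. -/
def bdryPt (a : Boundary) : SymMat :=
  ((rep a).1 ^ 2 / repNorm a, (rep a).1 * (rep a).2 / repNorm a, (rep a).2 ^ 2 / repNorm a)

/-- The linear form with null directions `u` and `v`. -/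
def pairForm (u v : ℝ × ℝ) : SymMat →ₗ[ℝ] ℝ where
  toFun X := u.2 * v.2 * X.1 - (u.1 * v.2 + u.2 * v.1) * X.2.1 + u.1 * v.1 * X.2.2
  map_add' X Y := by simp only [Prod.fst_add, Prod.snd_add]; ring
  map_smul' k X := by
    simp only [Prod.smul_fst, Prod.smul_snd, smul_eq_mul, RingHom.id_apply]; ring

theorem pairForm_apply (u v : ℝ × ℝ) (X : SymMat) : pairForm u v X =
    u.2 * v.2 * X.1 - (u.1 * v.2 + u.2 * v.1) * X.2.1 + u.1 * v.1 * X.2.2 := rfl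

theorem pairForm_comm (u v : ℝ × ℝ) : pairForm u v = pairForm v u := by
  ext <;> simp only [pairForm_apply, LinearMap.comp_apply] <;> ring

/-- The linear form on symmetric matrices whose kernel is spanned by a geodesic. -/
def Geod.form (g : Geod) : SymMat →ₗ[ℝ] ℝ :=
  Sym2.lift ⟨fun a b => pairForm (rep a) (rep b), fun _ _ => pairForm_comm _ _⟩ g.1

theorem form_mk (p : {p : Boundary × Boundary // p.1 ≠ p.2}) :
    (Geod.mk p).form = pairForm (rep p.1.1) (rep p.1.2) := rfl

theorem Geod.mk_surjective : Function.Surjective Geod.mk := by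
  rintro ⟨s, hs⟩
  induction s using Sym2.ind with
  | _ a b => exact ⟨⟨(a, b), fun h => hs (Sym2.mk_isDiag_iff.mpr h)⟩, rfl⟩

theorem Geod.mk_eq_iff {p q : {p : Boundary × Boundary // p.1 ≠ p.2}} :
    Geod.mk p = Geod.mk q ↔ p.1 = q.1 ∨ p.1 = q.1.swap := by
  refine Subtype.ext_iff.trans (Sym2.eq_iff.trans ?_)
  simp [Prod.ext_iff]

/-- The two by two determinant of homogeneous coordinates. -/
def wedge (u v : ℝ × ℝ) : ℝ := u.1 * v.2 - u.2 * v.1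

theorem wedge_rep_eq_zero {a b : Boundary} : wedge (rep a) (rep b) = 0 ↔ a = b := by
  rcases a with _ | a <;> rcases b with _ | b <;> simp [wedge, rep]
  · rfl
  · rw [sub_eq_zero]
    exact Option.some_inj.symm

theorem pairForm_bdryPt (u v : ℝ × ℝ) (a : Boundary) :
    pairForm u v (bdryPt a) = wedge (rep a) u * wedge (rep a) v / repNorm a := by
  simp only [pairForm_apply, bdryPt, wedge]
  ring

theorem mem_carrier_iff {g : Geod} {z : ℍ} : z ∈ g.carrier ↔ g.form (planePt z) = 0 := by
  obtain ⟨⟨⟨a, b⟩, hab⟩, rfl⟩ := Geod.mk_surjective g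
  have hz := z.im_ne_zero
  rw [form_mk]
  change endpointForm z a b = 0 ↔ _
  rcases a with _ | a <;> rcases b with _ | b <;>
    simp only [endpointForm, rep, pairForm_apply, planePt]
  · exact absurd rfl hab
  · have : (0 * 1 * ((z.re ^ 2 + z.im ^ 2) / z.im) - (1 * 1 + 0 * b) * (z.re / z.im) +
      1 * b * (1 / z.im)) = -(z.re - b) / z.im := by field_simp; ring
    rw [this, div_eq_zero_iff, neg_eq_zero, or_iff_left hz]
  · have : (1 * 0 * ((z.re ^ 2 + z.im ^ 2) / z.im) - (a * 0 + 1 * 1) * (z.re / z.im) +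
      a * 1 * (1 / z.im)) = -(z.re - a) / z.im := by field_simp; ring
    rw [this, div_eq_zero_iff, neg_eq_zero, or_iff_left hz]
  · have : (1 * 1 * ((z.re ^ 2 + z.im ^ 2) / z.im) - (a * 1 + 1 * b) * (z.re / z.im) +
      a * b * (1 / z.im)) = ((z.re - a) * (z.re - b) + z.im ^ 2) / z.im := by field_simp; ring
    rw [this]; simp [hz]

/-- A geodesic whose form vanishes at two distinct boundary points joins these. -/
theorem eq_mk_of_form_bdryPt {h : Geod} {p : {p : Boundary × Boundary // p.1 ≠ p.2}}
    (ha : h.form (bdryPt p.1.1) = 0) (hb : h.form (bdryPt p.1.2) = 0) : h = Geod.mk p := by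
  obtain ⟨⟨⟨u, v⟩, huv⟩, rfl⟩ := Geod.mk_surjective h
  obtain ⟨⟨a, b⟩, hab⟩ := p
  simp only [form_mk, pairForm_bdryPt, div_eq_zero_iff, mul_eq_zero, wedge_rep_eq_zero,
    (repNorm_pos _).ne', or_false] at ha hb
  rw [Geod.mk_eq_iff]
  rcases ha with rfl | rfl <;> rcases hb with rfl | rfl
  · exact absurd rfl hab
  · exact Or.inl rfl
  · exact Or.inr rfl
  · exact absurd rfl hab

theorem eq_of_ker_form_le {g h : Geod} (H : ∀ X, g.form X = 0 → h.form X = 0) : h = g := by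
  obtain ⟨⟨⟨u, v⟩, huv⟩, rfl⟩ := Geod.mk_surjective g
  apply eq_mk_of_form_bdryPt <;> apply H <;> rw [form_mk, pairForm_bdryPt] <;> simp [wedge] <;>
    left <;> [left; right] <;> ring

/-- A geodesic is determined by two linearly independent vectors of its plane. -/
theorem eq_of_form_eq_zero {g h : Geod} {X V : SymMat} (hX : X.2.2 ≠ 0) (hV0 : V ≠ 0)
    (hV : V.2.2 = 0) (gX : g.form X = 0) (gV : g.form V = 0) (hhX : h.form X = 0)
    (hhV : h.form V = 0) : g = h := by
  have aux : ∀ g : Geod, g.form X = 0 → g.form V = 0 → ∃ k : ℝ, ∀ Y, g.form Y =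
      k * (-V.2.1 * Y.1 + V.1 * Y.2.1 + (V.2.1 * X.1 - V.1 * X.2.1) / X.2.2 * Y.2.2) := by
    intro g h1 h2
    obtain ⟨p, rfl⟩ := Geod.mk_surjective g
    simp only [form_mk, pairForm_apply] at h1 h2 ⊢
    set l := (rep p.1.1).2 * (rep p.1.2).2
    set m := (rep p.1.1).1 * (rep p.1.2).2 + (rep p.1.1).2 * (rep p.1.2).1
    set n := (rep p.1.1).1 * (rep p.1.2).1
    rw [hV] at h2
    by_cases hv : V.1 = 0
    · have hv2 : V.2.1 ≠ 0 := fun h => hV0 (Prod.ext hv (Prod.ext h hV))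
      have hm : m = 0 := by
        rw [hv] at h2
        have : m * V.2.1 = 0 := by linarith
        exact (mul_eq_zero.mp this).resolve_right hv2
      refine ⟨-l / V.2.1, fun Y => ?_⟩
      have hn : n = -l * X.1 / X.2.2 := by
        rw [eq_div_iff hX]; rw [hm] at h1; linarith
      rw [hm, hv, hn]
      field_simp
      ring
    · refine ⟨-m / V.1, fun Y => ?_⟩
      have hl : l = m * V.2.1 / V.1 := by rw [eq_div_iff hv]; linarith
      have hn : n = (m * X.2.1 - l * X.1) / X.2.2 := by rw [eq_div_iff hX]; linarith
      rw [hn, hl]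
      field_simp
      ring
  obtain ⟨k, hk⟩ := aux g gX gV
  obtain ⟨k', hk'⟩ := aux h hhX hhV
  by_cases h0 : k' = 0
  · refine eq_of_ker_form_le fun Y _ => ?_
    exfalso
    subst h0
    have hz : ∀ Y, h.form Y = 0 := fun Y => by rw [hk', zero_mul]
    have e : ∀ p, h = Geod.mk p := fun p => eq_mk_of_form_bdryPt (hz _) (hz _)
    have e1 := e ⟨((0 : ℝ), (1 : ℝ)), by simp⟩
    rw [e ⟨((0 : ℝ), (2 : ℝ)), by simp⟩, Geod.mk_eq_iff] at e1
    simp [Prod.ext_iff] at e1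
  · refine eq_of_ker_form_le fun Y hY => ?_
    rw [hk' Y] at hY
    rw [hk Y, (mul_eq_zero.mp hY).resolve_left h0, mul_zero]

theorem mem_crossing_iff {g : Geod} {x y : ℍ} : g ∈ crossing x y ↔
    SignType.sign (g.form (planePt x)) ≠ SignType.sign (g.form (planePt y)) := by
  have hx : x ∈ arc x y := by simp [arc]
  have hy : y ∈ arc x y := by simp [arc]
  constructor
  · rintro ⟨⟨z, hzg, hz⟩, hn⟩ he
    rw [mem_carrier_iff] at hzg
    obtain ⟨s, t, hs, ht, hst, e⟩ := exists_planePt_eq_of_mem_arc hz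
    rw [e, map_add, map_smul, map_smul, smul_eq_mul, smul_eq_mul] at hzg
    rcases lt_trichotomy (g.form (planePt x)) 0 with h | h | h
    · have h' : g.form (planePt y) < 0 := sign_eq_neg_one_iff.mp (he ▸ sign_neg h)
      rcases hs.lt_or_eq with h1 | h1
      · nlinarith [mul_neg_of_pos_of_neg h1 h, mul_nonpos_of_nonneg_of_nonpos ht h'.le]
      · have : 0 < t := by linarith
        nlinarith [mul_neg_of_pos_of_neg this h', mul_nonpos_of_nonneg_of_nonpos hs h.le]
    · have h' : g.form (planePt y) = 0 := by rwa [h, sign_zero, eq_comm, sign_eq_zero_iff] at he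
      refine hn fun w hw => ?_
      obtain ⟨s, t, -, -, -, e⟩ := exists_planePt_eq_of_mem_arc hw
      rw [mem_carrier_iff, e, map_add, map_smul, map_smul, h, h', smul_zero, smul_zero, add_zero]
    · have h' : 0 < g.form (planePt y) := sign_eq_one_iff.mp (he ▸ sign_pos h)
      rcases hs.lt_or_eq with h1 | h1
      · nlinarith [mul_pos h1 h, mul_nonneg ht h'.le]
      · have : 0 < t := by linarith
        nlinarith [mul_pos this h', mul_nonneg hs h.le]
  · intro hne
    have hnz : ¬ (g.form (planePt x) = 0 ∧ g.form (planePt y) = 0) := fun h =>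
      hne (by rw [h.1, h.2])
    refine ⟨?_, fun hsub => hnz ⟨mem_carrier_iff.mp (hsub hx), mem_carrier_iff.mp (hsub hy)⟩⟩
    have hpos : 0 < |g.form (planePt y)| + |g.form (planePt x)| := by
      by_contra hcon
      have h1 := abs_nonneg (g.form (planePt x))
      have h2 := abs_nonneg (g.form (planePt y))
      exact hnz ⟨abs_eq_zero.mp (by linarith), abs_eq_zero.mp (by linarith)⟩
    obtain ⟨z, hz, k, hk, e⟩ := exists_mem_arc_of_combination (x := x) (y := y)
      (abs_nonneg (g.form (planePt y))) (abs_nonneg (g.form (planePt x))) hpos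
    refine ⟨z, ?_, hz⟩
    rw [mem_carrier_iff]
    have h := congrArg g.form e
    rw [map_add, map_smul, map_smul, map_smul, smul_eq_mul, smul_eq_mul, smul_eq_mul] at h
    have h0 : |g.form (planePt y)| * g.form (planePt x) +
        |g.form (planePt x)| * g.form (planePt y) = 0 := by
      rcases lt_trichotomy (g.form (planePt x)) 0 with h1 | h1 | h1 <;>
      rcases lt_trichotomy (g.form (planePt y)) 0 with h2 | h2 | h2
      · exact absurd (by rw [sign_neg h1, sign_neg h2]) hne
      · simp [h2]
      · rw [abs_of_neg h1, abs_of_pos h2]; ring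
      · simp [h1]
      · simp [h1]
      · simp [h1]
      · rw [abs_of_pos h1, abs_of_neg h2]; ring
      · simp [h2]
      · exact absurd (by rw [sign_pos h1, sign_pos h2]) hne
    rw [h0] at h
    exact (mul_eq_zero.mp h).resolve_left hk.ne'

theorem crossing_self (x : ℍ) : crossing x x = ∅ := by
  ext g; simp [mem_crossing_iff]

theorem crossing_comm (x y : ℍ) : crossing x y = crossing y x := by
  ext g; simp [mem_crossing_iff, eq_comm]

theorem crossing_subset_union (x y z : ℍ) : crossing x z ⊆ crossing x y ∪ crossing y z := by
  intro g
  simp only [Set.mem_union, mem_crossing_iff]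
  contrapose!
  exact fun h => h.1.trans h.2

/-! ### Equivariance -/

/-- The action of `SL(2,ℝ)` on symmetric matrices. -/
def symAct (M : SL(2, ℝ)) : SymMat →ₗ[ℝ] SymMat where
  toFun X := (M 0 0 ^ 2 * X.1 + 2 * M 0 0 * M 0 1 * X.2.1 + M 0 1 ^ 2 * X.2.2,
    M 0 0 * M 1 0 * X.1 + (M 0 0 * M 1 1 + M 0 1 * M 1 0) * X.2.1 + M 0 1 * M 1 1 * X.2.2,
    M 1 0 ^ 2 * X.1 + 2 * M 1 0 * M 1 1 * X.2.1 + M 1 1 ^ 2 * X.2.2)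
  map_add' X Y := by
    ext <;> simp only [Prod.fst_add, Prod.snd_add] <;> ring
  map_smul' k X := by
    ext <;> simp only [Prod.smul_fst, Prod.smul_snd, smul_eq_mul, RingHom.id_apply] <;> ring

theorem symAct_apply (M : SL(2, ℝ)) (X : SymMat) : symAct M X =
    (M 0 0 ^ 2 * X.1 + 2 * M 0 0 * M 0 1 * X.2.1 + M 0 1 ^ 2 * X.2.2,
    M 0 0 * M 1 0 * X.1 + (M 0 0 * M 1 1 + M 0 1 * M 1 0) * X.2.1 + M 0 1 * M 1 1 * X.2.2,
    M 1 0 ^ 2 * X.1 + 2 * M 1 0 * M 1 1 * X.2.1 + M 1 1 ^ 2 * X.2.2) := rfl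

theorem det_eq_one (M : SL(2, ℝ)) : M 0 0 * M 1 1 - M 0 1 * M 1 0 = 1 := by
  have := M.det_coe
  rwa [Matrix.det_fin_two] at this

theorem mk_smul_plane (M : SL(2, ℝ)) (z : ℍ) : (QuotientGroup.mk M : PSL(2, ℝ)) • z = M • z := rfl

theorem mk_smul_bdry (M : SL(2, ℝ)) (a : Boundary) : (QuotientGroup.mk M : PSL(2, ℝ)) • a =
    Matrix.SpecialLinearGroup.toGL M • a := rfl

theorem planePt_smul (M : SL(2, ℝ)) (z : ℍ) : planePt (M • z) = symAct M (planePt z) := by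
  have hz := z.im_ne_zero
  have hd := det_eq_one M
  have hden : ((M 1 0 : ℝ) : ℂ) * z + (M 1 1 : ℝ) ≠ 0 := by
    intro h
    have h1 := congrArg Complex.im h
    have h2 := congrArg Complex.re h
    simp [hz] at h1 h2
    rw [h1] at h2
    simp at h2
    rw [h1, h2] at hd
    simp at hd
  have e : ((M • z : ℍ) : ℂ) * ((M 1 0 : ℝ) * z + (M 1 1 : ℝ)) = (M 0 0 : ℝ) * z + (M 0 1 : ℝ) := by
    rw [UpperHalfPlane.coe_specialLinearGroup_apply]
    simpa using div_mul_cancel₀ _ hden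
  have e1 := congrArg Complex.re e
  have e2 := congrArg Complex.im e
  simp at e1 e2
  have hw := (M • z).im_ne_zero
  generalize M • z = w at *
  simp only [planePt, symAct_apply]
  generalize z.re = x at *
  generalize z.im = y at *
  generalize w.re = u at *
  generalize w.im = v at *
  generalize M 0 0 = a at *
  generalize M 0 1 = b at *
  generalize M 1 0 = c at *
  generalize M 1 1 = d at *
  have him : v * ((c * x + d) ^ 2 + (c * y) ^ 2) = y := by
    linear_combination (c * x + d) * e2 - c * y * e1 + y * hd
  have hre : u * ((c * x + d) ^ 2 + (c * y) ^ 2) = (a * x + b) * (c * x + d) + a * c * y ^ 2 := by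
    linear_combination (c * x + d) * e1 + c * y * e2
  have hn : (u ^ 2 + v ^ 2) * ((c * x + d) ^ 2 + (c * y) ^ 2) = (a * x + b) ^ 2 + (a * y) ^ 2 := by
    linear_combination (u * (c * x + d) - v * (c * y) + (a * x + b)) * e1 +
      (u * (c * y) + v * (c * x + d) + a * y) * e2
  have hD : v⁻¹ = ((c * x + d) ^ 2 + (c * y) ^ 2) / y := by
    rw [eq_div_iff hz, inv_mul_eq_iff_eq_mul₀ hw, him]
  refine Prod.ext ?_ (Prod.ext ?_ ?_)
  · simp only [div_eq_mul_inv (u ^ 2 + v ^ 2), hD, ← mul_div_assoc, hn]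
    field_simp
    ring
  · simp only [div_eq_mul_inv u, hD, ← mul_div_assoc, hre]
    field_simp
    ring
  · simp only [one_div, hD]
    field_simp
    ring

theorem rep_smul (M : SL(2, ℝ)) (a : Boundary) :
    ∃ k : ℝ, k ≠ 0 ∧ rep ((QuotientGroup.mk M : PSL(2, ℝ)) • a) =
      (k * (M 0 0 * (rep a).1 + M 0 1 * (rep a).2), k * (M 1 0 * (rep a).1 + M 1 1 * (rep a).2)) := by
  have hd := det_eq_one M
  rw [mk_smul_bdry]
  induction a using OnePoint.rec with
  | infty =>
    rw [OnePoint.smul_infty_eq_ite]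
    split_ifs with h
    · have h' : M 1 0 = 0 := h
      have h0 : M 0 0 ≠ 0 := by rintro h0; rw [h0, h'] at hd; simp at hd
      refine ⟨(M 0 0)⁻¹, inv_ne_zero h0, ?_⟩
      simp [rep, h', h0]
    · have h' : M 1 0 ≠ 0 := h
      refine ⟨(M 1 0)⁻¹, inv_ne_zero h', ?_⟩
      simp [rep, h', div_eq_inv_mul]
  | coe t =>
    rw [OnePoint.smul_some_eq_ite]
    split_ifs with h
    · have h' : M 1 0 * t + M 1 1 = 0 := h
      have h0 : M 0 0 * t + M 0 1 ≠ 0 := by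
        intro h0
        have : M 1 0 * (M 0 0 * t + M 0 1) = M 0 0 * (M 1 0 * t + M 1 1) - 1 := by
          linear_combination -hd
        rw [h0, h'] at this
        simp at this
      refine ⟨(M 0 0 * t + M 0 1)⁻¹, inv_ne_zero h0, ?_⟩
      simp [rep, h', h0]
    · have h' : M 1 0 * t + M 1 1 ≠ 0 := h
      refine ⟨(M 1 0 * t + M 1 1)⁻¹, inv_ne_zero h', ?_⟩
      simp [rep, h', div_eq_inv_mul]

theorem pairForm_symAct (M : SL(2, ℝ)) (u v : ℝ × ℝ) (k l : ℝ) (X : SymMat) :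
    pairForm (k * (M 0 0 * u.1 + M 0 1 * u.2), k * (M 1 0 * u.1 + M 1 1 * u.2))
      (l * (M 0 0 * v.1 + M 0 1 * v.2), l * (M 1 0 * v.1 + M 1 1 * v.2)) (symAct M X) =
      k * l * pairForm u v X := by
  have hd := det_eq_one M
  simp only [pairForm_apply, symAct_apply]
  have hd2 : (M 0 0 * M 1 1 - M 0 1 * M 1 0) ^ 2 = 1 := by rw [hd]; ring
  linear_combination (k * l * (u.2 * v.2 * X.1 - (u.1 * v.2 + u.2 * v.1) * X.2.1 +
    u.1 * v.1 * X.2.2)) * hd2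

theorem smul_mk (γ : PSL(2, ℝ)) (p : {p : Boundary × Boundary // p.1 ≠ p.2}) :
    γ • Geod.mk p = Geod.mk ⟨(γ • p.1.1, γ • p.1.2),
      fun h => p.2 (MulAction.injective γ h)⟩ := rfl

theorem form_smul (M : SL(2, ℝ)) (g : Geod) : ∃ k : ℝ, k ≠ 0 ∧ ∀ X,
    ((QuotientGroup.mk M : PSL(2, ℝ)) • g).form (symAct M X) = k * g.form X := by
  obtain ⟨p, rfl⟩ := Geod.mk_surjective g
  obtain ⟨k, hk, ek⟩ := rep_smul M p.1.1
  obtain ⟨l, hl, el⟩ := rep_smul M p.1.2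
  refine ⟨k * l, mul_ne_zero hk hl, fun X => ?_⟩
  rw [smul_mk, form_mk, form_mk, ek, el, pairForm_symAct]

theorem form_smul_planePt (γ : PSL(2, ℝ)) (g : Geod) : ∃ k : ℝ, k ≠ 0 ∧ ∀ z : ℍ,
    (γ • g).form (planePt (γ • z)) = k * g.form (planePt z) := by
  obtain ⟨M, rfl⟩ := QuotientGroup.mk_surjective γ
  obtain ⟨k, hk, h⟩ := form_smul M g
  exact ⟨k, hk, fun z => by rw [mk_smul_plane, planePt_smul, h]⟩

theorem smul_mem_carrier_smul {γ : PSL(2, ℝ)} {g : Geod} {z : ℍ} :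
    γ • z ∈ (γ • g).carrier ↔ z ∈ g.carrier := by
  obtain ⟨k, hk, h⟩ := form_smul_planePt γ g
  rw [mem_carrier_iff, mem_carrier_iff, h, mul_eq_zero, or_iff_right hk]

theorem smul_mem_crossing_smul {γ : PSL(2, ℝ)} {g : Geod} {x y : ℍ} :
    γ • g ∈ crossing (γ • x) (γ • y) ↔ g ∈ crossing x y := by
  obtain ⟨k, hk, h⟩ := form_smul_planePt γ g
  rw [mem_crossing_iff, mem_crossing_iff, h, h, sign_mul, sign_mul, ne_eq, ne_eq,
    mul_right_inj' (by simpa using hk)]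

theorem transverse_smul {γ : PSL(2, ℝ)} {g h : Geod} :
    Transverse (γ • g) (γ • h) ↔ Transverse g h := by
  refine and_congr (MulAction.injective γ).ne_iff ⟨?_, ?_⟩
  · rintro ⟨z, h1, h2⟩
    rw [← smul_inv_smul γ z, smul_mem_carrier_smul] at h1 h2
    exact ⟨_, h1, h2⟩
  · rintro ⟨z, h1, h2⟩
    exact ⟨γ • z, smul_mem_carrier_smul.mpr h1, smul_mem_carrier_smul.mpr h2⟩

instance : IsIsometricSMul PSL(2, ℝ) ℍ where
  isometry_smul γ := by
    obtain ⟨M, rfl⟩ := QuotientGroup.mk_surjective γ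
    exact isometry_smul ℍ M

/-! ### Topology of the space of geodesics -/

theorem continuous_bdryPt : Continuous bdryPt := by
  rw [OnePoint.continuous_iff]
  constructor
  · rw [coclosedCompact_eq_cocompact]
    have hn : Tendsto (fun a : ℝ => |a|) (cocompact ℝ) atTop := tendsto_norm_cocompact_atTop
    have h3 : Tendsto (fun a : ℝ => 1 / (a ^ 2 + 1)) (cocompact ℝ) (𝓝 0) := by
      simp only [one_div]
      refine tendsto_inv_atTop_zero.comp (tendsto_atTop_add_const_right _ _ ?_)
      have := (tendsto_pow_atTop (α := ℝ) two_ne_zero).comp hn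
      refine this.congr fun a => ?_
      simp
    have h2 : Tendsto (fun a : ℝ => a / (a ^ 2 + 1)) (cocompact ℝ) (𝓝 0) := by
      refine squeeze_zero_norm (fun a => ?_) (tendsto_inv_atTop_zero.comp hn)
      rw [norm_div, Real.norm_eq_abs, Real.norm_eq_abs, abs_of_pos (by positivity : 0 < a ^ 2 + 1)]
      rcases eq_or_ne a 0 with rfl | ha
      · simp
      · have : 0 < |a| := abs_pos.mpr ha
        simp only [Function.comp]
        rw [div_le_iff₀ (by positivity), inv_mul_eq_div, le_div_iff₀ this, ← sq, sq_abs]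
        linarith
    have h1 : Tendsto (fun a : ℝ => a ^ 2 / (a ^ 2 + 1)) (cocompact ℝ) (𝓝 1) := by
      have := (tendsto_const_nhds (x := (1 : ℝ))).sub h3
      rw [sub_zero] at this
      refine this.congr fun a => ?_
      have : a ^ 2 + 1 ≠ 0 := by positivity
      field_simp
      ring
    have := h1.prodMk_nhds (h2.prodMk_nhds h3)
    convert! this using 2
    · ext <;> simp [bdryPt, rep, repNorm]
    · simp [bdryPt, rep, repNorm]
  · have : (fun a : ℝ => bdryPt a) = fun a : ℝ =>
        (a ^ 2 / (a ^ 2 + 1), a / (a ^ 2 + 1), 1 / (a ^ 2 + 1)) := by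
      funext a
      simp [bdryPt, rep, repNorm]
    rw [this]
    have h : ∀ a : ℝ, a ^ 2 + 1 ≠ 0 := fun a => by positivity
    fun_prop (disch := assumption)

theorem bdryPt_injective : Function.Injective bdryPt := by
  intro a b h
  have h1 := pairForm_bdryPt (rep b) (rep b) a
  rw [h, pairForm_bdryPt, wedge_rep_eq_zero.mpr rfl] at h1
  simp only [zero_mul, zero_div] at h1
  have := (div_eq_zero_iff.mp h1.symm).resolve_right (repNorm_pos a).ne'
  exact wedge_rep_eq_zero.mp (mul_self_eq_zero.mp this)

theorem isClosedEmbedding_bdryPt : IsClosedEmbedding bdryPt :=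
  continuous_bdryPt.isClosedEmbedding bdryPt_injective

theorem exists_bdryPt_eq {X : SymMat} (htr : X.1 + X.2.2 = 1) (hdet : X.1 * X.2.2 = X.2.1 ^ 2) :
    ∃ a, bdryPt a = X := by
  obtain ⟨A, B, C⟩ := X
  simp only at htr hdet
  by_cases hC : C = 0
  · refine ⟨OnePoint.infty, ?_⟩
    have hB : B = 0 := by
      rw [hC, mul_zero] at hdet
      exact pow_eq_zero_iff two_ne_zero |>.mp hdet.symm
    have hA : A = 1 := by linarith
    simp [bdryPt, rep, repNorm, hA, hB, hC]
  · refine ⟨((B / C : ℝ) : Boundary), ?_⟩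
    have h : (B / C) ^ 2 + 1 = 1 / C := by
      field_simp
      rw [← hdet]; linear_combination C * htr
    simp only [bdryPt, rep, repNorm, one_pow, h, mul_one]
    refine Prod.ext ?_ (Prod.ext ?_ ?_)
    · field_simp
      linarith
    · field_simp
    · field_simp

/-- The product of the values of the form of a geodesic at two matrices, normalized, as a
polynomial in the endpoints. -/
def sepPoly (P R X Y : SymMat) : ℝ :=
  P.2.2 * R.2.2 * (X.1 * Y.1) - (P.2.1 * R.2.2 + P.2.2 * R.2.1) * (X.1 * Y.2.1 + X.2.1 * Y.1)
  + P.2.1 * R.2.1 * (X.1 * Y.2.2 + X.2.2 * Y.1)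
  + (P.1 * R.2.2 + 2 * (P.2.1 * R.2.1) + P.2.2 * R.1) * (X.2.1 * Y.2.1)
  - (P.1 * R.2.1 + P.2.1 * R.1) * (X.2.1 * Y.2.2 + X.2.2 * Y.2.1) + P.1 * R.1 * (X.2.2 * Y.2.2)

theorem sepPoly_bdryPt (a b : Boundary) (X Y : SymMat) :
    sepPoly (bdryPt a) (bdryPt b) X Y =
      pairForm (rep a) (rep b) X * pairForm (rep a) (rep b) Y / (repNorm a * repNorm b) := by
  have ha := (repNorm_pos a).ne'
  have hb := (repNorm_pos b).ne'
  simp only [sepPoly, bdryPt, pairForm_apply]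
  field_simp
  ring

theorem continuous_sepPoly {T : Type*} [TopologicalSpace T] {P R X Y : T → SymMat}
    (hP : Continuous P) (hR : Continuous R) (hX : Continuous X) (hY : Continuous Y) :
    Continuous fun t => sepPoly (P t) (R t) (X t) (Y t) := by
  unfold sepPoly
  fun_prop

theorem form_mul_form_neg_iff {p : {p : Boundary × Boundary // p.1 ≠ p.2}} {X Y : SymMat} :
    (Geod.mk p).form X * (Geod.mk p).form Y < 0 ↔
      sepPoly (bdryPt p.1.1) (bdryPt p.1.2) X Y < 0 := by
  rw [sepPoly_bdryPt, form_mk, div_lt_iff₀ (mul_pos (repNorm_pos _) (repNorm_pos _)), zero_mul]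

theorem form_mul_form_eq_zero_iff {p : {p : Boundary × Boundary // p.1 ≠ p.2}} {X Y : SymMat} :
    (Geod.mk p).form X * (Geod.mk p).form Y = 0 ↔
      sepPoly (bdryPt p.1.1) (bdryPt p.1.2) X Y = 0 := by
  rw [sepPoly_bdryPt, form_mk, div_eq_zero_iff,
    or_iff_left (mul_pos (repNorm_pos _) (repNorm_pos _)).ne']

theorem Geod.isOpenQuotientMap_mk : IsOpenQuotientMap Geod.mk := by
  refine .of_isOpenMap_isQuotientMap (fun U hU => ?_) ⟨⟨rfl⟩, Geod.mk_surjective⟩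
  rw [isOpen_coinduced]
  let σ : {p : Boundary × Boundary // p.1 ≠ p.2} → {p : Boundary × Boundary // p.1 ≠ p.2} :=
    fun p => ⟨p.1.swap, p.2.symm⟩
  have hσ : Continuous σ := (continuous_swap.comp continuous_subtype_val).subtype_mk _
  have : Geod.mk ⁻¹' (Geod.mk '' U) = U ∪ σ ⁻¹' U := by
    ext p
    simp only [Set.mem_preimage, Set.mem_image, Geod.mk_eq_iff, Set.mem_union]
    constructor
    · rintro ⟨q, hq, h | h⟩
      · left; rwa [← Subtype.ext h]
      · right
        have : σ p = q := Subtype.ext h.symm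
        rwa [this]
    · rintro (h | h)
      · exact ⟨p, h, Or.inl rfl⟩
      · exact ⟨_, h, Or.inr rfl⟩
  rw [this]
  exact hU.union (hU.preimage hσ)

instance : SecondCountableTopology Boundary :=
  isClosedEmbedding_bdryPt.isInducing.secondCountableTopology

instance : SecondCountableTopology Geod :=
  haveI : SecondCountableTopology {p : Boundary × Boundary // p.1 ≠ p.2} :=
    IsEmbedding.subtypeVal.isInducing.secondCountableTopology
  Geod.isOpenQuotientMap_mk.isQuotientMap.secondCountableTopology
    Geod.isOpenQuotientMap_mk.isOpenMap

instance : T1Space Geod where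
  t1 g := by
    obtain ⟨p, rfl⟩ := Geod.mk_surjective g
    rw [← Geod.isOpenQuotientMap_mk.isQuotientMap.isClosed_preimage]
    refine Set.Finite.isClosed (Set.Finite.subset
      (Set.toFinite {p, ⟨p.1.swap, p.2.symm⟩}) fun q hq => ?_)
    rcases Geod.mk_eq_iff.mp hq with h | h
    · exact Or.inl (Subtype.ext h)
    · exact Or.inr (Subtype.ext h)

theorem isOpen_form_mul_form_neg (X Y : SymMat) : IsOpen {g : Geod | g.form X * g.form Y < 0} := by
  rw [← Geod.isOpenQuotientMap_mk.isQuotientMap.isOpen_preimage]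
  have : Geod.mk ⁻¹' {g : Geod | g.form X * g.form Y < 0} =
      {p | sepPoly (bdryPt p.1.1) (bdryPt p.1.2) X Y < 0} := by
    ext p; exact form_mul_form_neg_iff
  rw [this]
  have hc := continuous_bdryPt
  refine isOpen_lt (continuous_sepPoly ?_ ?_ continuous_const continuous_const) continuous_const <;>
    fun_prop

theorem isClosed_form_eq_zero (X : SymMat) : IsClosed {g : Geod | g.form X = 0} := by
  rw [← Geod.isOpenQuotientMap_mk.isQuotientMap.isClosed_preimage]
  have : Geod.mk ⁻¹' {g : Geod | g.form X = 0} =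
      {p | sepPoly (bdryPt p.1.1) (bdryPt p.1.2) X X = 0} := by
    ext p
    refine Iff.trans ?_ form_mul_form_eq_zero_iff
    exact mul_self_eq_zero.symm
  rw [this]
  have hc := continuous_bdryPt
  refine isClosed_eq (continuous_sepPoly ?_ ?_ continuous_const continuous_const) continuous_const <;>
    fun_prop

theorem measurableSet_crossing (x y : ℍ) : MeasurableSet (crossing x y) := by
  have h0 := isOpen_form_mul_form_neg (planePt x) (planePt y)
  have h1 := isClosed_form_eq_zero (planePt x)
  have h2 := isClosed_form_eq_zero (planePt y)
  have : crossing x y = {g : Geod | g.form (planePt x) * g.form (planePt y) < 0} ∪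
      (({g : Geod | g.form (planePt x) = 0} \ {g : Geod | g.form (planePt y) = 0}) ∪
      ({g : Geod | g.form (planePt y) = 0} \ {g : Geod | g.form (planePt x) = 0})) := by
    ext g
    simp only [mem_crossing_iff, Set.mem_union, Set.mem_sdiff, Set.mem_ofPred_eq]
    rcases lt_trichotomy (g.form (planePt x)) 0 with h1 | h1 | h1 <;>
      rcases lt_trichotomy (g.form (planePt y)) 0 with h2 | h2 | h2 <;>
      simp [sign_neg, sign_pos, h1, h2, mul_neg_iff, ne_of_lt, ne_of_gt, not_lt_of_gt]
  rw [this]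
  exact h0.measurableSet.union ((h1.measurableSet.diff h2.measurableSet).union
    (h2.measurableSet.diff h1.measurableSet))

theorem exists_nhds_form_mul_form_neg {ι : Type*} {l : Filter ι} {X Y : ι → SymMat} {P R : SymMat}
    (hX : Tendsto X l (𝓝 P)) (hY : Tendsto Y l (𝓝 R)) {h : Geod} (hh : h.form P * h.form R < 0) :
    ∃ U ∈ 𝓝 h, ∀ᶠ i in l, ∀ g ∈ U, g.form (X i) * g.form (Y i) < 0 := by
  obtain ⟨p, rfl⟩ := Geod.mk_surjective h
  rw [form_mul_form_neg_iff] at hh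
  have hc := continuous_bdryPt
  have hcont : Continuous fun t : (SymMat × SymMat) × {p : Boundary × Boundary // p.1 ≠ p.2} =>
      sepPoly (bdryPt t.2.1.1) (bdryPt t.2.1.2) t.1.1 t.1.2 := by
    apply continuous_sepPoly <;> fun_prop
  have hev := hcont.continuousAt.eventually_lt
    (continuousAt_const (x := ((P, R), p)) (y := (0 : ℝ))) hh
  rw [nhds_prod_eq] at hev
  obtain ⟨s, hs, t, ht, hst⟩ := Filter.eventually_prod_iff.mp hev
  refine ⟨Geod.mk '' {q | t q}, Geod.isOpenQuotientMap_mk.isOpenMap.image_mem_nhds ht, ?_⟩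
  filter_upwards [(hX.prodMk_nhds hY).eventually hs] with i hi
  rintro _ ⟨q, hq, rfl⟩
  rw [form_mul_form_neg_iff]
  exact hst hi hq

theorem pairForm_self_pos (u : Boundary) (z : ℍ) : 0 < pairForm (rep u) (rep u) (planePt z) := by
  have hA := planePt_fst_pos z
  have hC := planePt_snd_pos z
  have hd := planePt_det z
  have hu := repNorm_pos u
  rw [pairForm_apply]
  rw [repNorm] at hu
  set A := (planePt z).1
  set B := (planePt z).2.1
  set C := (planePt z).2.2
  set x := (rep u).1
  set y := (rep u).2
  have h : A * (y * y * A - (x * y + y * x) * B + x * x * C) = (y * A - x * B) ^ 2 + x ^ 2 := by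
    linear_combination x ^ 2 * hd
  have hpos : 0 < (y * A - x * B) ^ 2 + x ^ 2 := by
    by_cases hx : x = 0
    · have hy : y ≠ 0 := by rintro hy; simp [hx, hy] at hu
      rw [hx]; simp; positivity
    · positivity
  rw [← h] at hpos
  exact pos_of_mul_pos_right hpos hA.le

/-- The geodesics that meet a compact set form a compact set. -/
theorem isCompact_setOf_meets {K : Set ℍ} (hK : IsCompact K) :
    IsCompact {g : Geod | ∃ z ∈ K, z ∈ g.carrier} := by
  have hc := continuous_bdryPt
  have hp := continuous_planePt
  have hcont : Continuous fun t : ℍ × Boundary × Boundary =>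
      sepPoly (bdryPt t.2.1) (bdryPt t.2.2) (planePt t.1) (planePt t.1) := by
    apply continuous_sepPoly <;> fun_prop
  have h1 : IsCompact ((K ×ˢ (Set.univ : Set (Boundary × Boundary))) ∩
      {t | sepPoly (bdryPt t.2.1) (bdryPt t.2.2) (planePt t.1) (planePt t.1) = 0}) :=
    (hK.prod isCompact_univ).inter_right (isClosed_eq hcont continuous_const)
  have h2 := h1.image continuous_snd
  set C := Prod.snd '' ((K ×ˢ (Set.univ : Set (Boundary × Boundary))) ∩
      {t | sepPoly (bdryPt t.2.1) (bdryPt t.2.2) (planePt t.1) (planePt t.1) = 0}) with hC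
  have hne : ∀ p ∈ C, p.1 ≠ p.2 := by
    rintro _ ⟨⟨z, p⟩, ⟨-, h⟩, rfl⟩ heq
    obtain ⟨a, b⟩ := p
    obtain rfl : a = b := heq
    have h' : sepPoly (bdryPt a) (bdryPt a) (planePt z) (planePt z) = 0 := h
    rw [sepPoly_bdryPt] at h'
    have h1 := pairForm_self_pos a z
    have h2 := repNorm_pos a
    have h3 : 0 < pairForm (rep a) (rep a) (planePt z) * pairForm (rep a) (rep a) (planePt z) /
      (repNorm a * repNorm a) := by positivity
    exact h3.ne' h'
  have h3 : IsCompact ((Subtype.val : {p : Boundary × Boundary // p.1 ≠ p.2} → _) ⁻¹' C) := by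
    rw [Subtype.isCompact_iff]
    convert! h2 using 1
    exact Set.image_preimage_eq_of_subset fun p hp => ⟨⟨p, hne p hp⟩, rfl⟩
  convert! h3.image Geod.isOpenQuotientMap_mk.continuous using 1
  ext g
  constructor
  · rintro ⟨z, hz, hg⟩
    obtain ⟨p, rfl⟩ := Geod.mk_surjective g
    refine ⟨p, ⟨(z, p.1), ⟨⟨hz, trivial⟩, ?_⟩, rfl⟩, rfl⟩
    rw [mem_carrier_iff] at hg
    exact form_mul_form_eq_zero_iff.mp (by rw [hg, zero_mul])
  · rintro ⟨p, ⟨⟨z, q⟩, ⟨⟨hz, -⟩, h⟩, rfl⟩, rfl⟩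
    exact ⟨z, hz, mem_carrier_iff.mpr (mul_self_eq_zero.mp (form_mul_form_eq_zero_iff.mpr h))⟩

theorem crossing_subset_meets (x y : ℍ) :
    crossing x y ⊆ {g : Geod | ∃ z ∈ Metric.closedBall x (dist x y), z ∈ g.carrier} := by
  rintro g ⟨⟨z, hz, hzxy⟩, -⟩
  refine ⟨z, ?_, hz⟩
  have : dist x z + dist z y = dist x y := hzxy
  rw [Metric.mem_closedBall, dist_comm]
  linarith [dist_nonneg (x := z) (y := y)]

theorem measure_meets_lt_top (ν : Measure Geod) [IsLocallyFiniteMeasure ν] {K : Set ℍ}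
    (hK : IsCompact K) : ν {g : Geod | ∃ z ∈ K, z ∈ g.carrier} < ∞ :=
  (isCompact_setOf_meets hK).measure_lt_top

theorem measure_crossing_lt_top (ν : Measure Geod) [IsLocallyFiniteMeasure ν] (x y : ℍ) :
    ν (crossing x y) < ∞ :=
  (measure_mono (crossing_subset_meets x y)).trans_lt
    (measure_meets_lt_top ν (isCompact_closedBall _ _))

/-! ### Transverse geodesics -/

theorem exists_planePt_eq_of_mem_carrier {p : {p : Boundary × Boundary // p.1 ≠ p.2}} {z : ℍ}
    (hz : z ∈ (Geod.mk p).carrier) :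
    ∃ s t : ℝ, 0 < s ∧ 0 < t ∧ planePt z = s • bdryPt p.1.1 + t • bdryPt p.1.2 := by
  rw [mem_carrier_iff, form_mk] at hz
  have h1 := pairForm_self_pos p.1.1 z
  have h2 := pairForm_self_pos p.1.2 z
  have hw : wedge (rep p.1.1) (rep p.1.2) ≠ 0 := fun h => p.2 (wedge_rep_eq_zero.mp h)
  have n1 := repNorm_pos p.1.1
  have n2 := repNorm_pos p.1.2
  have hw2 : 0 < wedge (rep p.1.1) (rep p.1.2) ^ 2 := by positivity
  refine ⟨pairForm (rep p.1.2) (rep p.1.2) (planePt z) * repNorm p.1.1 /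
      wedge (rep p.1.1) (rep p.1.2) ^ 2,
    pairForm (rep p.1.1) (rep p.1.1) (planePt z) * repNorm p.1.2 /
      wedge (rep p.1.1) (rep p.1.2) ^ 2, by positivity, by positivity, ?_⟩
  simp only [bdryPt, Prod.smul_mk, Prod.mk_add_mk, smul_eq_mul]
  refine Prod.ext ?_ (Prod.ext ?_ ?_) <;> simp only <;> field_simp <;>
    simp only [pairForm_apply, wedge] at hz ⊢
  · linear_combination (-2 * (rep p.1.1).1 * (rep p.1.2).1) * hz
  · linear_combination (-((rep p.1.1).1 * (rep p.1.2).2 + (rep p.1.1).2 * (rep p.1.2).1)) * hz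
  · linear_combination (-2 * (rep p.1.1).2 * (rep p.1.2).2) * hz

theorem transverse_mk_iff {p : {p : Boundary × Boundary // p.1 ≠ p.2}} {h : Geod} :
    Transverse (Geod.mk p) h ↔ h.form (bdryPt p.1.1) * h.form (bdryPt p.1.2) < 0 := by
  constructor
  · rintro ⟨hne, z, hz, hzh⟩
    obtain ⟨s, t, hs, ht, e⟩ := exists_planePt_eq_of_mem_carrier hz
    rw [mem_carrier_iff, e, map_add, map_smul, map_smul, smul_eq_mul, smul_eq_mul] at hzh
    have hnz : h.form (bdryPt p.1.1) ≠ 0 := by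
      intro h0
      rw [h0, mul_zero, zero_add] at hzh
      exact hne (eq_mk_of_form_bdryPt h0 ((mul_eq_zero.mp hzh).resolve_left ht.ne')).symm
    have e2 : t * (h.form (bdryPt p.1.1) * h.form (bdryPt p.1.2)) =
        -(s * h.form (bdryPt p.1.1) ^ 2) := by linear_combination h.form (bdryPt p.1.1) * hzh
    have : 0 < s * h.form (bdryPt p.1.1) ^ 2 := by positivity
    by_contra hcon
    have := mul_nonneg ht.le (not_lt.mp hcon)
    linarith
  · intro hneg
    have hne : Geod.mk p ≠ h := by
      rintro rfl
      rw [form_mk, pairForm_bdryPt, wedge_rep_eq_zero.mpr rfl] at hneg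
      simp at hneg
    have ha : h.form (bdryPt p.1.1) ≠ 0 := fun h0 => by simp [h0] at hneg
    have hb : h.form (bdryPt p.1.2) ≠ 0 := fun h0 => by simp [h0] at hneg
    set s := |h.form (bdryPt p.1.2)| with hs
    set t := |h.form (bdryPt p.1.1)| with ht
    have hs0 : 0 < s := abs_pos.mpr hb
    have ht0 : 0 < t := abs_pos.mpr ha
    have hw : wedge (rep p.1.1) (rep p.1.2) ≠ 0 := fun h => p.2 (wedge_rep_eq_zero.mp h)
    have n1 := repNorm_pos p.1.1
    have n2 := repNorm_pos p.1.2
    set X : SymMat := s • bdryPt p.1.1 + t • bdryPt p.1.2 with hX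
    have hdet : X.1 * X.2.2 - X.2.1 ^ 2 =
        s * t * wedge (rep p.1.1) (rep p.1.2) ^ 2 / (repNorm p.1.1 * repNorm p.1.2) := by
      simp only [hX, bdryPt, Prod.smul_mk, Prod.mk_add_mk, smul_eq_mul, wedge]
      field_simp
      ring
    have hdet0 : 0 < X.1 * X.2.2 - X.2.1 ^ 2 := by rw [hdet]; positivity
    have hC : 0 < X.2.2 := by
      have h1 : 0 ≤ X.2.2 := by
        simp only [hX, bdryPt, Prod.smul_mk, Prod.mk_add_mk, smul_eq_mul]
        positivity
      refine lt_of_le_of_ne h1 fun h0 => ?_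
      rw [← h0] at hdet0
      nlinarith [sq_nonneg X.2.1]
    obtain ⟨z, hz⟩ := exists_planePt hC hdet0
    have hk := (Real.sqrt_pos.mpr hdet0).ne'
    have key : ∀ g : Geod, g.form X = 0 → z ∈ g.carrier := by
      intro g hg
      rw [← hz, map_smul, smul_eq_mul] at hg
      exact mem_carrier_iff.mpr ((mul_eq_zero.mp hg).resolve_left hk)
    refine ⟨hne, z, key _ ?_, key _ ?_⟩
    · rw [hX, map_add, map_smul, map_smul, form_mk, pairForm_bdryPt, pairForm_bdryPt,
        wedge_rep_eq_zero.mpr rfl, wedge_rep_eq_zero.mpr rfl]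
      simp
    · rw [hX, map_add, map_smul, map_smul, smul_eq_mul, smul_eq_mul, hs, ht]
      rcases mul_neg_iff.mp hneg with ⟨h1, h2⟩ | ⟨h1, h2⟩
      · rw [abs_of_pos h1, abs_of_neg h2]; ring
      · rw [abs_of_neg h1, abs_of_pos h2]; ring

theorem isOpen_transverse : IsOpen {p : Geod × Geod | Transverse p.1 p.2} := by
  have hq := Geod.isOpenQuotientMap_mk
  have hpre : IsOpen ((Prod.map Geod.mk Geod.mk) ⁻¹' {p : Geod × Geod | Transverse p.1 p.2}) := by
    have : (Prod.map Geod.mk Geod.mk) ⁻¹' {p : Geod × Geod | Transverse p.1 p.2} =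
        {t | sepPoly (bdryPt t.2.1.1) (bdryPt t.2.1.2) (bdryPt t.1.1.1) (bdryPt t.1.1.2) < 0} := by
      ext t
      exact transverse_mk_iff.trans form_mul_form_neg_iff
    rw [this]
    have hc := continuous_bdryPt
    refine isOpen_lt (continuous_sepPoly ?_ ?_ ?_ ?_) continuous_const <;> fun_prop
  have := (hq.isOpenMap.prodMap hq.isOpenMap) _ hpre
  rwa [Set.image_preimage_eq _ (hq.surjective.prodMap hq.surjective)] at this

/-! ### Continuity of the action -/

theorem continuous_smul_boundary (γ : PSL(2, ℝ)) : Continuous fun a : Boundary => γ • a := by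
  obtain ⟨M, rfl⟩ := QuotientGroup.mk_surjective γ
  rw [isClosedEmbedding_bdryPt.isInducing.continuous_iff]
  have hform : ∀ a, bdryPt ((QuotientGroup.mk M : PSL(2, ℝ)) • a) =
      ((symAct M (bdryPt a)).1 + (symAct M (bdryPt a)).2.2)⁻¹ • symAct M (bdryPt a) ∧
      (symAct M (bdryPt a)).1 + (symAct M (bdryPt a)).2.2 ≠ 0 := by
    intro a
    obtain ⟨k, hk, e⟩ := rep_smul M a
    have hN := repNorm_pos ((QuotientGroup.mk M : PSL(2, ℝ)) • a)
    have hNa := repNorm_pos a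
    have hE : (symAct M (bdryPt a)).1 + (symAct M (bdryPt a)).2.2 =
        repNorm ((QuotientGroup.mk M : PSL(2, ℝ)) • a) / (k ^ 2 * repNorm a) := by
      rw [repNorm, e]
      simp only [symAct_apply, bdryPt]
      field_simp
      ring
    rw [hE]
    refine ⟨?_, by positivity⟩
    rw [bdryPt, e]
    simp only [symAct_apply, bdryPt, Prod.smul_mk, smul_eq_mul]
    refine Prod.ext ?_ (Prod.ext ?_ ?_) <;> simp only <;> field_simp
    · ring
    · ring
    · ring
  have : bdryPt ∘ (fun a : Boundary => (QuotientGroup.mk M : PSL(2, ℝ)) • a) = fun a =>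
      ((symAct M (bdryPt a)).1 + (symAct M (bdryPt a)).2.2)⁻¹ • symAct M (bdryPt a) :=
    funext fun a => (hform a).1
  rw [this]
  have hc : Continuous fun a => symAct M (bdryPt a) :=
    (LinearMap.continuous_of_finiteDimensional _).comp continuous_bdryPt
  exact ((hc.fst.add hc.snd.snd).inv₀ fun a => (hform a).2).smul hc

instance : ContinuousConstSMul PSL(2, ℝ) Geod where
  continuous_const_smul γ := by
    rw [← Geod.isOpenQuotientMap_mk.continuous_comp_iff]
    have := continuous_smul_boundary γ
    have h : Continuous fun p : {p : Boundary × Boundary // p.1 ≠ p.2} =>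
        (γ • p.1.1, γ • p.1.2) := by fun_prop
    exact Geod.isOpenQuotientMap_mk.continuous.comp
      (h.subtype_mk fun p e => p.2 (MulAction.injective γ e))

/-! ### Precompactness for the crossing semi-distance -/

theorem eventually_sign_eq {ι : Type*} {l : Filter ι} {f : ι → ℝ} {a : ℝ}
    (hf : Tendsto f l (𝓝 a)) (ha : a ≠ 0) :
    ∀ᶠ i in l, SignType.sign (f i) = SignType.sign a := by
  rcases ha.lt_or_gt with h | h
  · filter_upwards [hf.eventually (gt_mem_nhds h)] with i hi
    rw [sign_neg hi, sign_neg h]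
  · filter_upwards [hf.eventually (lt_mem_nhds h)] with i hi
    rw [sign_pos hi, sign_pos h]

theorem exists_subseq_sign_const (s : ℕ → SignType) :
    ∃ (φ : ℕ → ℕ) (c : SignType), StrictMono φ ∧ ∀ n, s (φ n) = c := by
  obtain ⟨c, hc⟩ := Finite.exists_infinite_fiber s
  have hinf : (s ⁻¹' {c}).Infinite := Set.infinite_coe_iff.mp hc
  obtain ⟨φ, hφ, h⟩ := extraction_of_frequently_atTop (Nat.frequently_atTop_iff_infinite.mpr hinf)
  exact ⟨φ, c, hφ, h⟩

theorem exists_subseq_eventually_sign_eq {x : ℕ → ℍ} {p : ℍ} (hx : Tendsto x atTop (𝓝 p)) :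
    ∃ φ : ℕ → ℕ, StrictMono φ ∧ ∀ g : Geod, ∃ c : SignType,
      ∀ᶠ n in atTop, SignType.sign (g.form (planePt (x (φ n)))) = c := by
  by_cases hfreq : ∃ᶠ n in atTop, x n = p
  · obtain ⟨φ, hφ, h⟩ := extraction_of_frequently_atTop hfreq
    exact ⟨φ, hφ, fun g => ⟨_, Eventually.of_forall fun n => by rw [h n]⟩⟩
  rw [not_frequently] at hfreq
  set Y : ℍ → SymMat := fun z => z.im • planePt z with hY
  have hYc : Continuous Y := UpperHalfPlane.continuous_im.smul continuous_planePt
  have hYs : ∀ (g : Geod) z, SignType.sign (g.form (planePt z)) = SignType.sign (g.form (Y z)) := by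
    intro g z
    rw [hY, map_smul, smul_eq_mul, sign_mul, sign_pos z.im_pos, one_mul]
  have hY3 : ∀ z, (Y z).2.2 = 1 := by
    intro z
    have := z.im_ne_zero
    simp [hY, planePt, this]
  have hYinj : ∀ z w, Y z = Y w → z = w := by
    intro z w h
    simp only [hY, planePt, Prod.smul_mk, smul_eq_mul, Prod.mk.injEq] at h
    have hz := z.im_ne_zero
    have hw := w.im_ne_zero
    have hre : z.re = w.re := by
      have := h.2.1
      field_simp at this
      exact this
    have him : z.im ^ 2 = w.im ^ 2 := by
      have := h.1
      rw [hre] at this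
      field_simp at this
      linarith
    exact UpperHalfPlane.ext (Complex.ext hre
      ((pow_left_inj₀ z.im_pos.le w.im_pos.le two_ne_zero).mp him))
  set D : ℕ → SymMat := fun n => Y (x n) - Y p with hD
  have hDne : ∀ᶠ n in atTop, D n ≠ 0 := by
    filter_upwards [hfreq] with n hn h
    exact hn (hYinj _ _ (sub_eq_zero.mp h))
  have hsph : ∀ᶠ n in atTop, ‖D n‖⁻¹ • D n ∈ Metric.sphere (0 : SymMat) 1 := by
    filter_upwards [hDne] with n hn
    rw [mem_sphere_zero_iff_norm, norm_smul, norm_inv, norm_norm,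
      inv_mul_cancel₀ (norm_ne_zero_iff.mpr hn)]
  obtain ⟨V, hV, φ, hφ, hlim⟩ := (isCompact_sphere (0 : SymMat) 1).tendsto_subseq' hsph.frequently
  have hV0 : V ≠ 0 := by
    rintro rfl
    simp at hV
  have hV3 : V.2.2 = 0 := by
    have h1 : Tendsto (fun n => (‖D (φ n)‖⁻¹ • D (φ n)).2.2) atTop (𝓝 V.2.2) :=
      (continuous_snd.comp continuous_snd).continuousAt.tendsto.comp hlim
    refine tendsto_nhds_unique h1 ?_
    have : (fun n => (‖D (φ n)‖⁻¹ • D (φ n)).2.2) = fun _ => (0 : ℝ) := by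
      funext n
      simp [hD, hY3]
    rw [this]
    exact tendsto_const_nhds
  have hgood : ∀ g : Geod, ¬ (g.form (Y p) = 0 ∧ g.form V = 0) → ∃ c : SignType,
      ∀ᶠ n in atTop, SignType.sign (g.form (planePt (x (φ n)))) = c := by
    intro g hg
    have hgc : Continuous g.form := LinearMap.continuous_of_finiteDimensional _
    by_cases h0 : g.form (Y p) = 0
    · have hgV : g.form V ≠ 0 := fun h => hg ⟨h0, h⟩
      refine ⟨SignType.sign (g.form V), ?_⟩
      have h1 : Tendsto (fun n => g.form (‖D (φ n)‖⁻¹ • D (φ n))) atTop (𝓝 (g.form V)) :=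
        (hgc.tendsto V).comp hlim
      filter_upwards [eventually_sign_eq h1 hgV, hφ.tendsto_atTop.eventually hDne] with n hn hne
      have e : g.form (D (φ n)) = g.form (Y (x (φ n))) := by
        simp only [hD, map_sub, h0, sub_zero]
      rw [← hn, hYs, map_smul (g.form) (‖D (φ n)‖⁻¹), smul_eq_mul, sign_mul,
        sign_pos (inv_pos.mpr (norm_pos_iff.mpr hne)), one_mul, e]
    · refine ⟨SignType.sign (g.form (Y p)), ?_⟩
      have h1 : Tendsto (fun n => g.form (Y (x (φ n)))) atTop (𝓝 (g.form (Y p))) :=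
        ((hgc.comp hYc).tendsto p).comp (hx.comp hφ.tendsto_atTop)
      filter_upwards [eventually_sign_eq h1 h0] with n hn
      rw [← hn, hYs]
  by_cases hex : ∃ g : Geod, g.form (Y p) = 0 ∧ g.form V = 0
  · obtain ⟨g₀, h1, h2⟩ := hex
    obtain ⟨ψ, c, hψ, hc⟩ :=
      exists_subseq_sign_const fun n => SignType.sign (g₀.form (planePt (x (φ n))))
    refine ⟨φ ∘ ψ, hφ.comp hψ, fun g => ?_⟩
    by_cases hg : g.form (Y p) = 0 ∧ g.form V = 0
    · have : g = g₀ := eq_of_form_eq_zero (X := Y p) (by rw [hY3]; exact one_ne_zero) hV0 hV3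
        hg.1 hg.2 h1 h2
      exact ⟨c, Eventually.of_forall fun n => this ▸ hc n⟩
    · obtain ⟨c, hc⟩ := hgood g hg
      exact ⟨c, hψ.tendsto_atTop.eventually hc⟩
  · exact ⟨φ, hφ, fun g => hgood g fun h => hex ⟨g, h⟩⟩

theorem exists_subseq_measure_crossing_lt (ν : Measure Geod) [IsLocallyFiniteMeasure ν]
    {x : ℕ → ℍ} {p : ℍ} (hx : Tendsto x atTop (𝓝 p)) :
    ∃ φ : ℕ → ℕ, StrictMono φ ∧ ∀ ε : ℝ≥0∞, 0 < ε → ∃ N, ∀ n ≥ N, ∀ m ≥ N,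
      ν (crossing (x (φ n)) (x (φ m))) < ε := by
  obtain ⟨φ, hφ, h⟩ := exists_subseq_eventually_sign_eq hx
  refine ⟨φ, hφ, fun ε hε => ?_⟩
  set B : ℕ → Set Geod := fun N => ⋃ n : ℕ, ⋃ m : ℕ,
    crossing (x (φ (N + n))) (x (φ (N + m))) with hB
  have hmeas : ∀ N, MeasurableSet (B N) := fun N =>
    MeasurableSet.iUnion fun n => MeasurableSet.iUnion fun m => measurableSet_crossing _ _
  have hmem : ∀ {N n m}, N ≤ n → N ≤ m → crossing (x (φ n)) (x (φ m)) ⊆ B N := by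
    intro N n m hn hm g hg
    refine Set.mem_iUnion.mpr ⟨n - N, Set.mem_iUnion.mpr ⟨m - N, ?_⟩⟩
    rwa [Nat.add_sub_cancel' hn, Nat.add_sub_cancel' hm]
  have hanti : Antitone B := by
    intro N M hNM
    refine Set.iUnion_subset fun n => Set.iUnion_subset fun m => hmem ?_ ?_ <;> omega
  have hempty : ⋂ N, B N = ∅ := by
    rw [Set.eq_empty_iff_forall_notMem]
    intro g hg
    obtain ⟨c, hc⟩ := h g
    obtain ⟨N, hN⟩ := eventually_atTop.mp hc
    obtain ⟨n, hn⟩ := Set.mem_iUnion.mp (Set.mem_iInter.mp hg N)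
    obtain ⟨m, hm⟩ := Set.mem_iUnion.mp hn
    rw [mem_crossing_iff, hN _ (by omega), hN _ (by omega)] at hm
    exact hm rfl
  have hfin : ν (B 0) ≠ ∞ := by
    obtain ⟨R, hR⟩ := (Metric.isBounded_range_of_tendsto x hx).subset_closedBall p
    refine ((measure_mono ?_).trans_lt (measure_meets_lt_top ν
      (isCompact_closedBall p (R + (R + R))))).ne
    refine Set.iUnion_subset fun n => Set.iUnion_subset fun m => ?_
    refine (crossing_subset_meets _ _).trans ?_
    rintro g ⟨z, hz, hg⟩
    refine ⟨z, ?_, hg⟩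
    have h1 : dist (x (φ (0 + n))) p ≤ R := hR ⟨_, rfl⟩
    have h2 : dist (x (φ (0 + m))) p ≤ R := hR ⟨_, rfl⟩
    rw [Metric.mem_closedBall] at hz ⊢
    have h3 := dist_triangle_right (x (φ (0 + n))) (x (φ (0 + m))) p
    have h4 := dist_triangle z (x (φ (0 + n))) p
    linarith
  have hlim := tendsto_measure_iInter_atTop (μ := ν)
    (fun N => (hmeas N).nullMeasurableSet) hanti ⟨0, hfin⟩
  rw [hempty, measure_empty] at hlim
  obtain ⟨N, hN⟩ := eventually_atTop.mp (hlim.eventually (gt_mem_nhds hε))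
  exact ⟨N, fun n hn m hm => (measure_mono (hmem hn hm)).trans_lt (hN N le_rfl)⟩

/-! ### The dual space of a current -/

/-- The hyperbolic plane, with the crossing semi-distance of a current. -/
def DualPlane (_ν : Measure Geod) : Type := ℍ

/-- The identity map onto the hyperbolic plane with the crossing semi-distance. -/
def toDual (ν : Measure Geod) (x : ℍ) : DualPlane ν := x

instance (ν : Measure Geod) (Γ : Subgroup PSL(2, ℝ)) : MulAction Γ (DualPlane ν) :=
  inferInstanceAs (MulAction Γ ℍ)

theorem measure_crossing_smul (ν : Measure Geod) (Γ : Subgroup PSL(2, ℝ))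
    [SMulInvariantMeasure Γ Geod ν] (γ : Γ) (x y : ℍ) :
    ν (crossing (γ • x) (γ • y)) = ν (crossing x y) := by
  rw [← measure_preimage_smul ν γ (crossing (γ • x) (γ • y))]
  congr 1
  ext g
  exact smul_mem_crossing_smul

section
variable (ν : Measure Geod) [IsLocallyFiniteMeasure ν]

instance : PseudoMetricSpace (DualPlane ν) :=
  letI : PseudoEMetricSpace (DualPlane ν) :=
    { edist := fun x y => ν (crossing x y)
      edist_self := fun x => (congrArg ν (crossing_self x)).trans measure_empty
      edist_comm := fun x y => congrArg ν (crossing_comm x y)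
      edist_triangle := fun x y z =>
        (measure_mono (crossing_subset_union x y z)).trans (measure_union_le _ _) }
  PseudoEMetricSpace.toPseudoMetricSpace fun x y => (measure_crossing_lt_top ν x y).ne

theorem edist_toDual (x y : ℍ) : edist (toDual ν x) (toDual ν y) = ν (crossing x y) := rfl

variable (Γ : Subgroup PSL(2, ℝ))

instance [SMulInvariantMeasure Γ Geod ν] : IsIsometricSMul Γ (DualPlane ν) where
  isometry_smul γ x y := measure_crossing_smul ν Γ γ x y

instance [SMulInvariantMeasure Γ Geod ν] : UniformContinuousConstSMul Γ (DualPlane ν) where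
  uniformContinuous_const_smul γ := (isometry_smul (DualPlane ν) γ).uniformContinuous

/-- The dual space of a current. -/
abbrev DualSpace : Type := UniformSpace.Completion (DualPlane ν)

/-- The projection of the hyperbolic plane to the dual space. -/
def dualProj (x : ℍ) : DualSpace ν := (toDual ν x : UniformSpace.Completion (DualPlane ν))

theorem denseRange_dualProj : DenseRange (dualProj ν) :=
  UniformSpace.Completion.denseRange_coe (α := DualPlane ν)

theorem edist_dualProj (x y : ℍ) : edist (dualProj ν x) (dualProj ν y) = ν (crossing x y) := by
  rw [← edist_toDual]
  exact UniformSpace.Completion.edist_eq _ _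

theorem dist_dualProj (x y : ℍ) :
    dist (dualProj ν x) (dualProj ν y) = (ν (crossing x y)).toReal := by
  rw [dist_edist, edist_dualProj]

theorem dualProj_smul [SMulInvariantMeasure Γ Geod ν] (γ : Γ) (x : ℍ) :
    dualProj ν (γ • x) = γ • dualProj ν x :=
  UniformSpace.Completion.coe_smul γ (toDual ν x)

instance [SMulInvariantMeasure Γ Geod ν] : IsIsometricSMul Γ (DualSpace ν) where
  isometry_smul γ := (isometry_smul (DualPlane ν) γ).completion_map

/-- Images of compact sets are precompact in the dual space. -/
theorem isCompact_closure_dualProj_image {K : Set ℍ} (hK : IsCompact K) :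
    IsCompact (closure (dualProj ν '' K)) := by
  refine IsSeqCompact.isCompact fun y hy => ?_
  have : ∀ n : ℕ, ∃ k ∈ K, dist (y n) (dualProj ν k) < 1 / ((n : ℝ) + 1) := by
    intro n
    obtain ⟨_, ⟨k, hk, rfl⟩, h⟩ := Metric.mem_closure_iff.mp (hy n) _
      (Nat.one_div_pos_of_nat (α := ℝ) (n := n))
    exact ⟨k, hk, h⟩
  choose k hk hd using this
  obtain ⟨p, -, φ, hφ, hlim⟩ := hK.tendsto_subseq hk
  obtain ⟨ψ, hψ, hc⟩ := exists_subseq_measure_crossing_lt ν hlim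
  have hcau : CauchySeq fun n => dualProj ν (k (φ (ψ n))) := by
    refine EMetric.cauchySeq_iff.mpr fun ε hε => ?_
    obtain ⟨N, hN⟩ := hc ε hε
    refine ⟨N, fun n hn m hm => ?_⟩
    rw [edist_dualProj]
    exact hN n hn m hm
  obtain ⟨a, ha⟩ := cauchySeq_tendsto_of_complete hcau
  have hmono := hφ.comp hψ
  have hya : Tendsto (y ∘ (φ ∘ ψ)) atTop (𝓝 a) := by
    refine (tendsto_iff_of_dist ?_).mpr ha
    refine squeeze_zero (fun _ => dist_nonneg) (fun n => (hd (φ (ψ n))).le) ?_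
    exact (tendsto_one_div_add_atTop_nhds_zero_nat (𝕜 := ℝ)).comp hmono.tendsto_atTop
  exact ⟨a, isClosed_closure.mem_of_tendsto hya (Eventually.of_forall fun n => hy _),
    φ ∘ ψ, hmono, hya⟩

end

/-! ### Closed surface groups -/

instance (Γ : Subgroup PSL(2, ℝ)) : IsIsometricSMul Γ ℍ where
  isometry_smul γ := isometry_smul ℍ (γ : PSL(2, ℝ))

theorem IsClosedSurfaceGroup.exists_closedBall {Γ : Subgroup PSL(2, ℝ)}
    (hΓ : IsClosedSurfaceGroup Γ) :
    ∃ R : ℝ, ∀ z : ℍ, ∃ γ : Γ, γ • z ∈ Metric.closedBall I R := by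
  have hc := hΓ.compact_quotient
  let _ := MulAction.orbitRel Γ ℍ
  have ho : IsOpenMap (Quotient.mk' : ℍ → Quotient (MulAction.orbitRel Γ ℍ)) :=
    isOpenMap_quotient_mk'_mul
  obtain ⟨n, hn⟩ := isCompact_univ.elim_directed_cover
    (fun n : ℕ => (Quotient.mk' : ℍ → Quotient (MulAction.orbitRel Γ ℍ)) '' Metric.ball I n)
    (fun n => ho _ Metric.isOpen_ball) (by
      intro q _
      obtain ⟨z, rfl⟩ := Quotient.exists_rep q
      obtain ⟨n, hn⟩ := exists_nat_gt (dist z I)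
      exact Set.mem_iUnion.mpr ⟨n, z, hn, rfl⟩)
    (directed_of_isDirected_le fun n m h => Set.image_mono (Metric.ball_subset_ball (by exact_mod_cast h)))
  refine ⟨n, fun z => ?_⟩
  obtain ⟨w, hw, e⟩ := hn (Set.mem_univ (Quotient.mk' z))
  obtain ⟨γ, hγ⟩ := MulAction.orbitRel_apply.mp (Quotient.exact e)
  exact ⟨γ, by rw [show γ • z = w from hγ]; exact Metric.ball_subset_closedBall hw⟩

theorem IsClosedSurfaceGroup.finite_dist_le {Γ : Subgroup PSL(2, ℝ)}
    (hΓ : IsClosedSurfaceGroup Γ) (z w : ℍ) (r : ℝ) : {γ : Γ | dist z (γ • w) ≤ r}.Finite := by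
  have := hΓ.properlyDiscontinuous
  refine (ProperlyDiscontinuousSMul.finite_disjoint_inter_image (Γ := Γ)
    (isCompact_singleton (x := w)) (isCompact_closedBall z r)).subset fun γ hγ => ?_
  exact ⟨γ • w, ⟨w, rfl, rfl⟩, by rw [Metric.mem_closedBall, dist_comm]; exact hγ⟩

theorem IsClosedSurfaceGroup.countable {Γ : Subgroup PSL(2, ℝ)}
    (hΓ : IsClosedSurfaceGroup Γ) : Countable Γ := by
  rw [← Set.countable_univ_iff]
  have : (Set.univ : Set Γ) = ⋃ n : ℕ, {γ : Γ | dist I (γ • I) ≤ n} := by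
    symm
    rw [Set.eq_univ_iff_forall]
    intro γ
    obtain ⟨n, hn⟩ := exists_nat_ge (dist I (γ • I))
    exact Set.mem_iUnion.mpr ⟨n, hn⟩
  rw [this]
  exact Set.countable_iUnion fun n => (hΓ.finite_dist_le _ _ _).countable

/-- The displacement of nontrivial elements is bounded below. -/
theorem IsClosedSurfaceGroup.exists_le_dist_smul {Γ : Subgroup PSL(2, ℝ)}
    (hΓ : IsClosedSurfaceGroup Γ) :
    ∃ ε : ℝ, 0 < ε ∧ ∀ γ : Γ, γ ≠ 1 → ∀ z : ℍ, ε ≤ dist z (γ • z) := by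
  obtain ⟨R, hR⟩ := hΓ.exists_closedBall
  set F : Set Γ := {γ : Γ | dist I (γ • I) ≤ 2 * R + 1} with hF
  have hfin : F.Finite := hΓ.finite_dist_le _ _ _
  have hR0 : 0 ≤ R := by
    obtain ⟨γ, hγ⟩ := hR I
    exact dist_nonneg.trans hγ
  have h1 : ∀ γ ∈ F, ∀ᶠ ε in 𝓝[>] (0 : ℝ), γ ≠ 1 → ∀ z ∈ Metric.closedBall I R,
      ε ≤ dist z (γ • z) := by
    intro γ _
    by_cases hγ : γ = 1
    · exact Eventually.of_forall fun _ h => absurd hγ h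
    obtain ⟨w, -, hmin⟩ := (isCompact_closedBall I R).exists_isMinOn
      ⟨I, by simpa using hR0⟩
      (f := fun z : ℍ => dist z (γ • z))
      (continuous_id.dist (continuous_const_smul γ)).continuousOn
    have hpos : 0 < dist w (γ • w) := dist_pos.mpr fun h => hγ (hΓ.free γ w h.symm)
    filter_upwards [nhdsWithin_le_nhds (Iic_mem_nhds hpos)] with ε hε _ z hz
    exact le_trans hε (hmin hz)
  obtain ⟨ε, ⟨hε, hε1⟩, hε0⟩ := (((Filter.eventually_all_finite hfin).mpr h1).and
    (nhdsWithin_le_nhds (Iic_mem_nhds one_pos))).and (self_mem_nhdsWithin (s := Set.Ioi (0 : ℝ)))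
    |>.exists
  have key : ∀ γ : Γ, γ ≠ 1 → ∀ z ∈ Metric.closedBall I R, ε ≤ dist z (γ • z) := by
    intro γ hγ z hz
    by_cases hmem : γ ∈ F
    · exact hε γ hmem hγ z hz
    · have h2 : 2 * R + 1 < dist I (γ • I) := not_le.mp hmem
      have h3 : dist (γ • z) (γ • I) = dist z I := dist_smul _ _ _
      have h4 : dist z I ≤ R := hz
      have h5 := dist_triangle4 I z (γ • z) (γ • I)
      rw [dist_comm I z] at h5
      have h6 : ε ≤ 1 := hε1
      linarith
  refine ⟨ε, hε0, fun γ hγ z => ?_⟩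
  obtain ⟨δ, hδ⟩ := hR z
  have h := key (δ * γ * δ⁻¹) (by simpa using hγ) _ hδ
  rwa [smul_smul, inv_mul_cancel_right, mul_smul, dist_smul] at h

/-! ### Nontrivial elements are hyperbolic -/

theorem cosh_dist_smul (M : SL(2, ℝ)) (z : ℍ) : Real.cosh (dist z (M • z)) =
    1 + 2 * ((M 1 0 * (planePt z).1 - M 0 1 * (planePt z).2.2 -
      (M 0 0 - M 1 1) * (planePt z).2.1) / 2) ^ 2 + ((M 0 0 + M 1 1) ^ 2 - 4) / 2 := by
  have hd := det_eq_one M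
  have hp := planePt_det z
  rw [← pair_planePt, planePt_smul]
  simp only [SymMat.pair, symAct_apply]
  generalize (planePt z).1 = A at *
  generalize (planePt z).2.1 = B at *
  generalize (planePt z).2.2 = C at *
  generalize M 0 0 = a at *
  generalize M 0 1 = b at *
  generalize M 1 0 = c at *
  generalize M 1 1 = d at *
  linear_combination ((a ^ 2 + d ^ 2) / 2 + b * c) * hp - hd

theorem exists_fixed_of_trace_sq_lt {M : SL(2, ℝ)} (h : (M 0 0 + M 1 1) ^ 2 < 4) :
    ∃ z : ℍ, M • z = z := by
  have hd := det_eq_one M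
  have hc : M 1 0 ≠ 0 := by
    intro hc
    rw [hc, mul_zero, sub_zero] at hd
    nlinarith [sq_nonneg (M 0 0 - M 1 1)]
  obtain ⟨σ, hσ, hσc⟩ : ∃ σ : ℝ, σ ^ 2 = 1 ∧ 0 < σ * M 1 0 := by
    rcases hc.lt_or_gt with h | h
    · exact ⟨-1, by norm_num, by linarith⟩
    · exact ⟨1, by norm_num, by linarith⟩
  have hdet : (σ * -M 0 1) * (σ * M 1 0) - (σ * ((M 0 0 - M 1 1) / 2)) ^ 2 =
      (4 - (M 0 0 + M 1 1) ^ 2) / 4 := by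
    linear_combination (-M 0 1 * M 1 0 - ((M 0 0 - M 1 1) / 2) ^ 2) * hσ + hd
  obtain ⟨z, hz⟩ := exists_planePt
    (X := (σ * -M 0 1, σ * ((M 0 0 - M 1 1) / 2), σ * M 1 0)) hσc
    (by simp only; rw [hdet]; linarith)
  simp only [hdet] at hz
  have hk : Real.sqrt ((4 - (M 0 0 + M 1 1) ^ 2) / 4) ≠ 0 :=
    (Real.sqrt_pos.mpr (by linarith)).ne'
  refine ⟨z, planePt_injective ?_⟩
  rw [planePt_smul]
  refine smul_right_injective _ hk ?_
  simp only
  rw [← map_smul, hz, symAct_apply]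
  simp only
  refine Prod.ext ?_ (Prod.ext ?_ ?_) <;> simp only
  · linear_combination (-σ * M 0 1) * hd
  · linear_combination (σ * ((M 0 0 - M 1 1) / 2)) * hd
  · linear_combination (σ * M 1 0) * hd

theorem exists_dist_smul_lt_of_trace_sq_eq {M : SL(2, ℝ)} (h : (M 0 0 + M 1 1) ^ 2 = 4)
    {ε : ℝ} (hε : 0 < ε) : ∃ z : ℍ, dist z (M • z) < ε := by
  have hd := det_eq_one M
  suffices H : ∃ z : ℍ, 2 * ((M 1 0 * (planePt z).1 - M 0 1 * (planePt z).2.2 -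
      (M 0 0 - M 1 1) * (planePt z).2.1) / 2) ^ 2 < Real.cosh ε - 1 by
    obtain ⟨z, hz⟩ := H
    refine ⟨z, ?_⟩
    rw [← abs_of_nonneg (dist_nonneg (x := z) (y := M • z)), ← abs_of_pos hε, ← Real.cosh_lt_cosh,
      cosh_dist_smul, h]
    linarith
  have hη : 0 < Real.cosh ε - 1 := sub_pos.mpr (Real.one_lt_cosh.mpr hε.ne')
  set η := Real.cosh ε - 1
  have aux : ∀ k : ℝ, ∃ δ : ℝ, 0 < δ ∧ 2 * (k * δ) ^ 2 < η := by
    intro k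
    have hc : Continuous fun δ : ℝ => 2 * (k * δ) ^ 2 := by fun_prop
    have h0 := (hc.tendsto 0).eventually_lt_const (u := η) (by simpa using hη)
    obtain ⟨δ, h1, h2⟩ := ((h0.filter_mono (nhdsWithin_le_nhds (s := Set.Ioi (0 : ℝ)))).and
      (self_mem_nhdsWithin (s := Set.Ioi (0 : ℝ)))).exists
    exact ⟨δ, h2, h1⟩
  by_cases hc : M 1 0 = 0
  · obtain ⟨δ, hδ, hlt⟩ := aux (-M 0 1 / 2)
    have had : M 0 0 = M 1 1 := by
      rw [hc, mul_zero, sub_zero] at hd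
      have : (M 0 0 - M 1 1) ^ 2 = 0 := by linear_combination h - 4 * hd
      exact sub_eq_zero.mp (pow_eq_zero_iff two_ne_zero |>.mp this)
    refine ⟨⟨⟨0, δ⁻¹⟩, by simpa using hδ⟩, ?_⟩
    rw [hc, had]
    convert hlt using 3
    simp [planePt, UpperHalfPlane.im]
    ring
  · obtain ⟨δ, hδ, hlt⟩ := aux (M 1 0 / 2)
    refine ⟨⟨⟨(M 0 0 - M 1 1) / (2 * M 1 0), δ⟩, by simpa using hδ⟩, ?_⟩
    convert hlt using 3
    simp only [planePt, UpperHalfPlane.im, UpperHalfPlane.re]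
    field_simp
    linear_combination 4 * hd - h

theorem IsClosedSurfaceGroup.four_lt_trace_sq {Γ : Subgroup PSL(2, ℝ)}
    (hΓ : IsClosedSurfaceGroup Γ) {M : SL(2, ℝ)} (hM : (QuotientGroup.mk M : PSL(2, ℝ)) ∈ Γ)
    (h1 : (QuotientGroup.mk M : PSL(2, ℝ)) ≠ 1) : 4 < (M 0 0 + M 1 1) ^ 2 := by
  have hne : (⟨_, hM⟩ : Γ) ≠ 1 := fun h => h1 (congrArg Subtype.val h)
  by_contra hcon
  rcases (not_lt.mp hcon).lt_or_eq with h | h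
  · obtain ⟨z, hz⟩ := exists_fixed_of_trace_sq_lt h
    exact hne (hΓ.free ⟨_, hM⟩ z hz)
  · obtain ⟨ε, hε, H⟩ := hΓ.exists_le_dist_smul
    obtain ⟨z, hz⟩ := exists_dist_smul_lt_of_trace_sq_eq h hε
    exact absurd hz (not_lt.mpr (H ⟨_, hM⟩ hne z))

/-- The diagonal matrix with eigenvalues `k` and `k⁻¹`. -/
def diagSL (k : ℝ) (hk : k ≠ 0) : SL(2, ℝ) :=
  ⟨!![k, 0; 0, k⁻¹], by simp [Matrix.det_fin_two, hk]⟩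

theorem sl_mul_apply (A B : SL(2, ℝ)) (i j : Fin 2) :
    (A * B) i j = A i 0 * B 0 j + A i 1 * B 1 j := by
  rw [Matrix.SpecialLinearGroup.coe_mul, Matrix.mul_apply, Fin.sum_univ_two]

theorem exists_diagonalization {M : SL(2, ℝ)} (h : 4 < (M 0 0 + M 1 1) ^ 2) :
    ∃ (N : SL(2, ℝ)) (k : ℝ) (hk : k ≠ 0), 1 < k ^ 2 ∧ M * N = N * diagSL k hk := by
  have hd := det_eq_one M
  obtain ⟨k, hk1, hk2⟩ : ∃ k : ℝ, 1 < k ^ 2 ∧ k ^ 2 - (M 0 0 + M 1 1) * k + 1 = 0 := by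
    set t := M 0 0 + M 1 1
    have hs := Real.sq_sqrt (show 0 ≤ t ^ 2 - 4 by linarith)
    have hs0 := Real.sqrt_pos.mpr (show 0 < t ^ 2 - 4 by linarith)
    set s := Real.sqrt (t ^ 2 - 4)
    rcases le_or_gt 0 t with ht | ht
    · refine ⟨(t + s) / 2, ?_, by linear_combination hs / 4⟩
      have : 2 < t := by nlinarith
      nlinarith
    · refine ⟨(t - s) / 2, ?_, by linear_combination hs / 4⟩
      have : t < -2 := by nlinarith
      nlinarith
  have hk : k ≠ 0 := by rintro rfl; norm_num at hk1
  have hkk : k * k⁻¹ = 1 := mul_inv_cancel₀ hk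
  have hki : k⁻¹ = M 0 0 + M 1 1 - k := by
    field_simp
    linear_combination hk2
  have hne : k - k⁻¹ ≠ 0 := by
    intro h0
    have : k ^ 2 = 1 := by linear_combination k * h0 + hkk
    linarith
  suffices H : ∃ v0 v1 w0 w1 : ℝ, v0 * w1 - w0 * v1 ≠ 0 ∧
      M 0 0 * v0 + M 0 1 * v1 = k * v0 ∧ M 1 0 * v0 + M 1 1 * v1 = k * v1 ∧
      M 0 0 * w0 + M 0 1 * w1 = k⁻¹ * w0 ∧ M 1 0 * w0 + M 1 1 * w1 = k⁻¹ * w1 by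
    obtain ⟨v0, v1, w0, w1, hD, e1, e2, e3, e4⟩ := H
    set D := v0 * w1 - w0 * v1
    have hdet : !![v0, w0 / D; v1, w1 / D].det = 1 := by
      rw [Matrix.det_fin_two_of]
      field_simp
      ring
    refine ⟨⟨!![v0, w0 / D; v1, w1 / D], hdet⟩, k, hk, hk1, ?_⟩
    apply Matrix.SpecialLinearGroup.ext
    intro i j
    refine (sl_mul_apply _ _ i j).trans (Eq.trans ?_ (sl_mul_apply _ _ i j).symm)
    fin_cases i <;> fin_cases j
    · change M 0 0 * v0 + M 0 1 * v1 = v0 * k + w0 / D * 0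
      linarith
    · change M 0 0 * (w0 / D) + M 0 1 * (w1 / D) = v0 * 0 + w0 / D * k⁻¹
      linear_combination e3 / D
    · change M 1 0 * v0 + M 1 1 * v1 = v1 * k + w1 / D * 0
      linarith
    · change M 1 0 * (w0 / D) + M 1 1 * (w1 / D) = v1 * 0 + w1 / D * k⁻¹
      linear_combination e4 / D
  by_cases hc : M 1 0 = 0
  · rw [hc, mul_zero, sub_zero] at hd
    have hfac : (k - M 0 0) * (k - M 1 1) = 0 := by linear_combination hk2 + hd
    rcases mul_eq_zero.mp hfac with h0 | h0
    · have e : M 0 0 = k := by linarith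
      have e' : M 1 1 = k⁻¹ := by rw [hki]; linarith
      refine ⟨1, 0, -M 0 1, k - k⁻¹, by simpa using hne, ?_, ?_, ?_, ?_⟩ <;>
        simp only [hc, e, e'] <;> ring
    · have e : M 1 1 = k := by linarith
      have e' : M 0 0 = k⁻¹ := by rw [hki]; linarith
      refine ⟨M 0 1, k - k⁻¹, 1, 0, by simpa [sub_eq_zero, eq_comm] using hne, ?_, ?_, ?_, ?_⟩ <;>
        simp only [hc, e, e'] <;> ring
  · refine ⟨k - M 1 1, M 1 0, k⁻¹ - M 1 1, M 1 0, ?_, ?_, ?_, ?_, ?_⟩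
    · have : (k - M 1 1) * M 1 0 - (k⁻¹ - M 1 1) * M 1 0 = (k - k⁻¹) * M 1 0 := by ring
      rw [this]
      exact mul_ne_zero hne hc
    · linear_combination -hk2 - hd
    · ring
    · rw [hki]; linear_combination -hk2 - hd
    · ring

/-! ### Parametrized geodesic lines -/

/-- The unit speed parametrization of the image under `N` of the imaginary axis. -/
def linePt (N : SL(2, ℝ)) (t : ℝ) : ℍ := N • (UpperHalfPlane.mk ⟨0, Real.exp t⟩ (Real.exp_pos t))

/-- The forward endpoint of the line of `N`. -/
def lineFwd (N : SL(2, ℝ)) : SymMat := symAct N (1, 0, 0)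

/-- The backward endpoint of the line of `N`. -/
def lineBwd (N : SL(2, ℝ)) : SymMat := symAct N (0, 0, 1)

/-- The imaginary axis. -/
def axisGeod : Geod := Geod.mk ⟨(OnePoint.infty, ((0 : ℝ) : Boundary)), by simp⟩

/-- The image under `N` of the imaginary axis. -/
def lineGeod (N : SL(2, ℝ)) : Geod := (QuotientGroup.mk N : PSL(2, ℝ)) • axisGeod

theorem planePt_linePt (N : SL(2, ℝ)) (t : ℝ) :
    planePt (linePt N t) = Real.exp t • lineFwd N + Real.exp (-t) • lineBwd N := by
  rw [linePt, planePt_smul, lineFwd, lineBwd, ← map_smul, ← map_smul, ← map_add]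
  congr 1
  have := Real.exp_pos t
  simp only [planePt, UpperHalfPlane.re, UpperHalfPlane.im, Real.exp_neg]
  refine Prod.ext ?_ (Prod.ext ?_ ?_) <;> simp
  field_simp

theorem form_linePt (N : SL(2, ℝ)) (h : Geod) (t : ℝ) : h.form (planePt (linePt N t)) =
    Real.exp t * h.form (lineFwd N) + Real.exp (-t) * h.form (lineBwd N) := by
  rw [planePt_linePt, map_add, map_smul, map_smul, smul_eq_mul, smul_eq_mul]

theorem dist_linePt (N : SL(2, ℝ)) (s t : ℝ) : dist (linePt N s) (linePt N t) = |s - t| := by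
  rw [linePt, linePt, dist_smul]
  exact (isometry_vertical_line 0).dist_eq s t

theorem form_axisGeod (X : SymMat) : axisGeod.form X = -X.2.1 := by
  simp [axisGeod, form_mk, pairForm_apply, rep]

theorem eq_axisGeod {h : Geod} (h1 : h.form (1, 0, 0) = 0) (h2 : h.form (0, 0, 1) = 0) :
    h = axisGeod := by
  apply eq_mk_of_form_bdryPt
  · simpa [bdryPt, rep, repNorm] using h1
  · simpa [bdryPt, rep, repNorm] using h2

theorem eq_lineGeod_iff {N : SL(2, ℝ)} {h : Geod} :
    h = lineGeod N ↔ h.form (lineFwd N) = 0 ∧ h.form (lineBwd N) = 0 := by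
  set n : PSL(2, ℝ) := QuotientGroup.mk N with hn
  obtain ⟨k, hk, e⟩ := form_smul N (n⁻¹ • h)
  rw [← hn, smul_inv_smul] at e
  rw [lineFwd, lineBwd, e, e, mul_eq_zero, mul_eq_zero, or_iff_right hk, or_iff_right hk,
    lineGeod, ← hn, ← inv_smul_eq_iff]
  constructor
  · intro h
    rw [h, form_axisGeod, form_axisGeod]
    simp
  · exact fun h => eq_axisGeod h.1 h.2

theorem linePt_mem_lineGeod (N : SL(2, ℝ)) (t : ℝ) : linePt N t ∈ (lineGeod N).carrier := by
  obtain ⟨h1, h2⟩ := eq_lineGeod_iff.mp (rfl : lineGeod N = lineGeod N)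
  rw [mem_carrier_iff, form_linePt, h1, h2]
  simp

theorem form_fwd_ne_zero {N : SL(2, ℝ)} {h : Geod} (hne : h ≠ lineGeod N) {u : ℝ}
    (hu : linePt N u ∈ h.carrier) : h.form (lineFwd N) ≠ 0 := by
  intro h0
  rw [mem_carrier_iff, form_linePt, h0, mul_zero, zero_add] at hu
  exact hne (eq_lineGeod_iff.mpr ⟨h0, (mul_eq_zero.mp hu).resolve_left (Real.exp_pos _).ne'⟩)

theorem sign_form_linePt {N : SL(2, ℝ)} {h : Geod} {u : ℝ} (hu : linePt N u ∈ h.carrier) (t : ℝ) :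
    SignType.sign (h.form (planePt (linePt N t))) =
      SignType.sign (h.form (lineFwd N)) * SignType.sign (t - u) := by
  rw [mem_carrier_iff, form_linePt] at hu
  have hexp : Real.exp u * Real.exp (-u) = 1 := by rw [← Real.exp_add]; simp
  have e : h.form (planePt (linePt N t)) =
      h.form (lineFwd N) * (Real.exp t - Real.exp (2 * u - t)) := by
    rw [form_linePt]
    have h2 : Real.exp (2 * u - t) = Real.exp u * Real.exp u * Real.exp (-t) := by
      rw [← Real.exp_add, ← Real.exp_add]; ring_nf
    rw [h2]
    linear_combination (Real.exp u * Real.exp (-t)) * hu -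
      Real.exp (-t) * h.form (lineBwd N) * hexp
  rw [e, sign_mul]
  congr 1
  rcases lt_trichotomy t u with h1 | h1 | h1
  · rw [sign_neg (sub_neg.mpr h1), sign_neg (sub_neg.mpr (Real.exp_lt_exp.mpr (by linarith)))]
  · subst h1
    simp [two_mul]
  · rw [sign_pos (sub_pos.mpr h1), sign_pos (sub_pos.mpr (Real.exp_lt_exp.mpr (by linarith)))]

theorem linePt_mem_carrier_unique {N : SL(2, ℝ)} {h : Geod} (hne : h ≠ lineGeod N) {u v : ℝ}
    (hu : linePt N u ∈ h.carrier) (hv : linePt N v ∈ h.carrier) : u = v := by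
  have h1 := sign_form_linePt hu v
  rw [mem_carrier_iff.mp hv, sign_zero, eq_comm, mul_eq_zero, sign_eq_zero_iff,
    or_iff_right (form_fwd_ne_zero hne hu), sign_eq_zero_iff] at h1
  linarith

theorem mem_crossing_linePt {N : SL(2, ℝ)} {h : Geod} {s t : ℝ} (hst : s < t) :
    h ∈ crossing (linePt N s) (linePt N t) ↔
      h ≠ lineGeod N ∧ ∃ u ∈ Set.Icc s t, linePt N u ∈ h.carrier := by
  rw [mem_crossing_iff]
  constructor
  · intro hs
    refine ⟨?_, ?_⟩
    · rintro rfl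
      exact hs (by rw [mem_carrier_iff.mp (linePt_mem_lineGeod N s),
        mem_carrier_iff.mp (linePt_mem_lineGeod N t)])
    · set f : ℝ → ℝ := fun u => h.form (planePt (linePt N u)) with hf
      have hc : Continuous f := by
        simp only [hf, form_linePt]
        fun_prop
      have hmem : (0 : ℝ) ∈ Set.uIcc (f s) (f t) := by
        change SignType.sign (f s) ≠ SignType.sign (f t) at hs
        rw [Set.mem_uIcc]
        rcases lt_trichotomy (f s) 0 with h1 | h1 | h1 <;>
          rcases lt_trichotomy (f t) 0 with h2 | h2 | h2
        · exact absurd (by rw [sign_neg h1, sign_neg h2]) hs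
        · exact Or.inl ⟨h1.le, h2.ge⟩
        · exact Or.inl ⟨h1.le, h2.le⟩
        · exact Or.inr ⟨h2.le, h1.ge⟩
        · exact Or.inl ⟨h1.le, h2.ge⟩
        · exact Or.inl ⟨h1.le, h2.le⟩
        · exact Or.inr ⟨h2.le, h1.le⟩
        · exact Or.inr ⟨h2.le, h1.le⟩
        · exact absurd (by rw [sign_pos h1, sign_pos h2]) hs
      obtain ⟨u, hu, hu0⟩ := intermediate_value_uIcc hc.continuousOn hmem
      rw [Set.uIcc_of_le hst.le] at hu
      exact ⟨u, hu, mem_carrier_iff.mpr hu0⟩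
  · rintro ⟨hne, u, ⟨h1, h2⟩, hu⟩
    rw [sign_form_linePt hu, sign_form_linePt hu]
    have h0 : SignType.sign (h.form (lineFwd N)) ≠ 0 := by
      rw [ne_eq, sign_eq_zero_iff]
      exact form_fwd_ne_zero hne hu
    rw [ne_eq, mul_right_inj' h0]
    rcases h1.lt_or_eq with h3 | h3
    · rw [sign_neg (sub_neg.mpr h3)]
      intro h4
      have := sign_eq_neg_one_iff.mp h4.symm
      linarith
    · rw [h3, sub_self, sign_zero]
      intro h4
      have := sign_eq_zero_iff.mp h4.symm
      linarith

/-! ### Limits at infinity -/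

theorem trace_planePt (z : ℍ) : (planePt z).1 + (planePt z).2.2 = 2 * Real.cosh (dist I z) := by
  rw [← pair_planePt]
  simp [SymMat.pair, planePt]
  ring

/-- The matrix of a point of the plane, normalized to have trace one. -/
def normPt (z : ℍ) : SymMat := ((planePt z).1 + (planePt z).2.2)⁻¹ • planePt z

theorem trace_planePt_pos (z : ℍ) : 0 < (planePt z).1 + (planePt z).2.2 :=
  add_pos (planePt_fst_pos z) (planePt_snd_pos z)

theorem trace_smul_normPt (z : ℍ) :
    ((planePt z).1 + (planePt z).2.2) • normPt z = planePt z := by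
  rw [normPt, smul_smul, mul_inv_cancel₀ (trace_planePt_pos z).ne', one_smul]

theorem sign_form_normPt (g : Geod) (z : ℍ) :
    SignType.sign (g.form (normPt z)) = SignType.sign (g.form (planePt z)) := by
  rw [normPt, map_smul, smul_eq_mul, sign_mul, sign_pos (inv_pos.mpr (trace_planePt_pos z)),
    one_mul]

theorem trace_normPt (z : ℍ) : (normPt z).1 + (normPt z).2.2 = 1 := by
  have := (trace_planePt_pos z).ne'
  simp only [normPt, Prod.smul_fst, Prod.smul_snd, smul_eq_mul]
  field_simp

theorem det_normPt (z : ℍ) : (normPt z).1 * (normPt z).2.2 - (normPt z).2.1 ^ 2 =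
    (((planePt z).1 + (planePt z).2.2)⁻¹) ^ 2 := by
  have h := planePt_det z
  simp only [normPt, Prod.smul_fst, Prod.smul_snd, smul_eq_mul]
  linear_combination (((planePt z).1 + (planePt z).2.2)⁻¹) ^ 2 * h

theorem norm_normPt_le (z : ℍ) : ‖normPt z‖ ≤ 1 := by
  have h1 := trace_normPt z
  have h2 := det_normPt z
  have hA : 0 < (normPt z).1 := mul_pos (inv_pos.mpr (trace_planePt_pos z)) (planePt_fst_pos z)
  have hC : 0 < (normPt z).2.2 := mul_pos (inv_pos.mpr (trace_planePt_pos z)) (planePt_snd_pos z)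
  have h3 : (normPt z).2.1 ^ 2 ≤ 1 := by
    nlinarith [sq_nonneg (((planePt z).1 + (planePt z).2.2)⁻¹)]
  rw [Prod.norm_def, Prod.norm_def, max_le_iff, max_le_iff]
  refine ⟨?_, ?_, ?_⟩
  · rw [Real.norm_eq_abs, abs_of_pos hA]; linarith
  · rw [Real.norm_eq_abs]
    exact (sq_le_one_iff_abs_le_one _).mp h3
  · rw [Real.norm_eq_abs, abs_of_pos hC]; linarith

theorem exists_subseq_tendsto_bdryPt {y : ℕ → ℍ}
    (hy : Tendsto (fun n => dist I (y n)) atTop atTop) :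
    ∃ (φ : ℕ → ℕ) (b : Boundary), StrictMono φ ∧
      Tendsto (fun n => normPt (y (φ n))) atTop (𝓝 (bdryPt b)) := by
  obtain ⟨Z, -, φ, hφ, hlim⟩ := (isCompact_closedBall (0 : SymMat) 1).tendsto_subseq
    (x := fun n => normPt (y n)) fun n => by simpa using norm_normPt_le (y n)
  have h1 : Tendsto (fun n => (normPt (y (φ n))).1) atTop (𝓝 Z.1) :=
    (continuous_fst.tendsto Z).comp hlim
  have h2 : Tendsto (fun n => (normPt (y (φ n))).2.1) atTop (𝓝 Z.2.1) :=
    ((continuous_fst.comp continuous_snd).tendsto Z).comp hlim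
  have h3 : Tendsto (fun n => (normPt (y (φ n))).2.2) atTop (𝓝 Z.2.2) :=
    ((continuous_snd.comp continuous_snd).tendsto Z).comp hlim
  have htr : Z.1 + Z.2.2 = 1 := by
    refine tendsto_nhds_unique (h1.add h3) ?_
    simp only [trace_normPt]
    exact tendsto_const_nhds
  have hdet : Z.1 * Z.2.2 - Z.2.1 ^ 2 = 0 := by
    refine tendsto_nhds_unique ((h1.mul h3).sub (h2.pow 2)) ?_
    simp only [det_normPt, trace_planePt]
    have h4 : Tendsto (fun n => 2 * Real.cosh (dist I (y (φ n)))) atTop atTop := by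
      refine tendsto_atTop_mono (fun n => ?_) (hy.comp hφ.tendsto_atTop)
      have h5 := Real.cosh_sq (dist I (y (φ n)))
      have h6 : dist I (y (φ n)) ≤ Real.sinh (dist I (y (φ n))) :=
        Real.self_le_sinh_iff.mpr dist_nonneg
      have h7 := (Real.sinh_lt_cosh (dist I (y (φ n)))).le
      have h8 := Real.one_le_cosh (dist I (y (φ n)))
      simp only [Function.comp]
      linarith
    simpa using (tendsto_inv_atTop_zero.comp h4).pow 2
  obtain ⟨b, rfl⟩ := exists_bdryPt_eq htr (by linarith)
  exact ⟨φ, b, hφ, hlim⟩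

theorem exists_lineFwd_eq (b : Boundary) :
    ∃ N : SL(2, ℝ), ∃ k : ℝ, 0 < k ∧ lineFwd N = k • bdryPt b := by
  have hb := repNorm_pos b
  have hdet : !![(rep b).1, -(rep b).2 / repNorm b; (rep b).2, (rep b).1 / repNorm b].det = 1 := by
    rw [Matrix.det_fin_two_of]
    field_simp
    rw [repNorm]
    ring
  refine ⟨⟨_, hdet⟩, repNorm b, hb, ?_⟩
  have e : ∀ N : SL(2, ℝ), N 0 0 = (rep b).1 → N 1 0 = (rep b).2 →
      lineFwd N = repNorm b • bdryPt b := by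
    intro N h1 h2
    rw [lineFwd, symAct_apply, h1, h2, bdryPt]
    refine Prod.ext ?_ (Prod.ext ?_ ?_) <;> simp <;> field_simp
  exact e _ rfl rfl

theorem exists_planePt_smul_linear (γ : PSL(2, ℝ)) :
    ∃ L : SymMat →ₗ[ℝ] SymMat, ∀ z : ℍ, planePt (γ • z) = L (planePt z) := by
  obtain ⟨M, rfl⟩ := QuotientGroup.mk_surjective γ
  exact ⟨symAct M, fun z => planePt_smul M z⟩

theorem cosh_smul_planePt_linePt (N : SL(2, ℝ)) (k : ℝ) :
    (2 * Real.cosh k) • planePt (linePt N (2 * k)) =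
      planePt (linePt N k) + planePt (linePt N (3 * k)) := by
  have e1 : 2 * Real.cosh k * Real.exp (2 * k) = Real.exp k + Real.exp (3 * k) := by
    have h1 : Real.exp k = Real.exp (2 * k) * Real.exp (-k) := by rw [← Real.exp_add]; ring_nf
    have h2 : Real.exp (3 * k) = Real.exp (2 * k) * Real.exp k := by rw [← Real.exp_add]; ring_nf
    rw [Real.cosh_eq, h2]
    linear_combination -h1
  have e2 : 2 * Real.cosh k * Real.exp (-(2 * k)) = Real.exp (-k) + Real.exp (-(3 * k)) := by
    have h1 : Real.exp (-k) = Real.exp (-(2 * k)) * Real.exp k := by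
      rw [← Real.exp_add]; ring_nf
    have h2 : Real.exp (-(3 * k)) = Real.exp (-(2 * k)) * Real.exp (-k) := by
      rw [← Real.exp_add]; ring_nf
    rw [Real.cosh_eq, h2]
    linear_combination -h1
  rw [planePt_linePt, planePt_linePt, planePt_linePt, smul_add, smul_smul, smul_smul, e1, e2,
    add_smul, add_smul]
  abel

/-! ### Properness of the crossing semi-distance of a filling current -/

/-- The geodesics that separate the point at time `t` from the forward endpoint of a line. -/
def ahead (N : SL(2, ℝ)) (t : ℝ) : Set Geod :=
  {h | h.form (planePt (linePt N t)) * h.form (lineFwd N) < 0}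

theorem ahead_antitone (N : SL(2, ℝ)) : Antitone (ahead N) := by
  intro s t hst h hh
  simp only [ahead, Set.mem_ofPred_eq, form_linePt] at hh ⊢
  set α := h.form (lineFwd N)
  set β := h.form (lineBwd N)
  have e1 : Real.exp (s - t) * Real.exp t = Real.exp s := by rw [← Real.exp_add]; ring_nf
  have e2 : Real.exp (t - s) * Real.exp (-t) = Real.exp (-s) := by rw [← Real.exp_add]; ring_nf
  have h1 : Real.exp (s - t) ≤ Real.exp (t - s) := Real.exp_le_exp.mpr (by linarith)
  have h2 : (Real.exp s * α + Real.exp (-s) * β) * α =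
      Real.exp (t - s) * ((Real.exp t * α + Real.exp (-t) * β) * α) -
        (Real.exp (t - s) - Real.exp (s - t)) * (Real.exp t * α ^ 2) := by
    rw [← e1, ← e2]; ring
  rw [h2]
  have h3 := mul_neg_of_pos_of_neg (Real.exp_pos (t - s)) hh
  have h4 : 0 ≤ (Real.exp (t - s) - Real.exp (s - t)) * (Real.exp t * α ^ 2) :=
    mul_nonneg (by linarith) (by positivity)
  linarith

theorem iInter_ahead (N : SL(2, ℝ)) : ⋂ n : ℕ, ahead N n = ∅ := by
  rw [Set.eq_empty_iff_forall_notMem]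
  intro h hh
  have hh' : ∀ n : ℕ, (Real.exp n * h.form (lineFwd N) + Real.exp (-n) * h.form (lineBwd N)) *
      h.form (lineFwd N) < 0 := fun n => by
    have := Set.mem_iInter.mp hh n
    simpa only [ahead, Set.mem_ofPred_eq, form_linePt] using this
  set α := h.form (lineFwd N)
  set β := h.form (lineBwd N)
  have hα : α ≠ 0 := by
    intro h0
    have := hh' 0
    rw [h0] at this
    simp at this
  have hα2 : 0 < α ^ 2 := by positivity
  obtain ⟨n, hn⟩ := exists_nat_gt (|β * α| / α ^ 2)
  have h1 : |β * α| < n * α ^ 2 := (div_lt_iff₀ hα2).mp hn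
  have h2 : (n : ℝ) ≤ Real.exp n := by linarith [Real.add_one_le_exp (n : ℝ)]
  have h3 : Real.exp (-n) ≤ 1 := Real.exp_le_one_iff.mpr (by simp)
  have h4 : -|β * α| ≤ Real.exp (-n) * (β * α) := by
    have h5 := neg_abs_le (β * α)
    have h6 := (Real.exp_pos (-(n : ℝ))).le
    have h7 := abs_nonneg (β * α)
    nlinarith
  have h5 := hh' n
  have h6 : (n : ℝ) * α ^ 2 ≤ Real.exp n * α ^ 2 := mul_le_mul_of_nonneg_right h2 hα2.le
  nlinarith

theorem crossing_linePt_subset_ahead (N : SL(2, ℝ)) {r s t : ℝ} (hrs : r < s) (hst : s < t) :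
    crossing (linePt N s) (linePt N t) ⊆ ahead N r := by
  intro h hh
  obtain ⟨hne, u, ⟨hu1, -⟩, hu⟩ := (mem_crossing_linePt hst).mp hh
  have h0 := form_fwd_ne_zero hne hu
  have h1 := sign_form_linePt hu r
  rw [sign_neg (show r - u < 0 by linarith)] at h1
  rw [ahead, Set.mem_ofPred_eq, ← sign_eq_neg_one_iff, sign_mul, h1]
  rcases h0.lt_or_gt with h2 | h2
  · rw [sign_neg h2]; rfl
  · rw [sign_pos h2]; rfl

theorem measure_ahead_le (ν : Measure Geod) {N : SL(2, ℝ)} {b : Boundary} {k : ℝ} (hk : 0 < k)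
    (hN : lineFwd N = k • bdryPt b) {y : ℕ → ℍ}
    (hy : Tendsto (fun n => normPt (y n)) atTop (𝓝 (bdryPt b))) {t : ℝ} {r : ℝ≥0∞}
    (hr : ∀ n, ν (crossing (linePt N t) (y n)) ≤ r) : ν (ahead N t) ≤ r := by
  set s : ℕ → Set Geod := fun m => ⋂ n : ℕ, crossing (linePt N t) (y (m + n)) with hs
  have hmono : Monotone s := by
    intro m m' hmm
    refine Set.subset_iInter fun n => ?_
    refine (Set.iInter_subset _ (m' - m + n)).trans ?_
    rw [show m + (m' - m + n) = m' + n by omega]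
  have hsub : ahead N t ⊆ ⋃ m, s m := by
    intro h hh
    have hc : Continuous h.form := LinearMap.continuous_of_finiteDimensional _
    have hh' : h.form (planePt (linePt N t)) * h.form (bdryPt b) < 0 := by
      have h1 : h.form (planePt (linePt N t)) * h.form (lineFwd N) < 0 := hh
      rw [hN, map_smul, smul_eq_mul] at h1
      by_contra hcon
      have := mul_nonneg hk.le (not_lt.mp hcon)
      linarith
    have hlim : Tendsto (fun n => h.form (planePt (linePt N t)) * h.form (normPt (y n))) atTop
        (𝓝 (h.form (planePt (linePt N t)) * h.form (bdryPt b))) :=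
      tendsto_const_nhds.mul ((hc.tendsto _).comp hy)
    obtain ⟨m, hm⟩ := eventually_atTop.mp (hlim.eventually_lt_const hh')
    refine Set.mem_iUnion.mpr ⟨m, Set.mem_iInter.mpr fun n => ?_⟩
    rw [mem_crossing_iff, ← sign_form_normPt h (y (m + n))]
    intro he
    have h2 := sign_neg (hm (m + n) (by omega))
    rw [sign_mul, he] at h2
    revert h2
    generalize SignType.sign (h.form (normPt (y (m + n)))) = σ
    revert σ
    decide
  calc ν (ahead N t) ≤ ν (⋃ m, s m) := measure_mono hsub
    _ = ⨆ m, ν (s m) := hmono.measure_iUnion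
    _ ≤ r := iSup_le fun m => (measure_mono (Set.iInter_subset _ 0)).trans (hr _)

theorem not_bdryPt_eq_of_combination {m : ℕ → ℍ} {w : ℍ} (hm : Tendsto m atTop (𝓝 w))
    {A B : ℕ → SymMat} {P : SymMat} (hP : P.1 * P.2.2 = P.2.1 ^ 2)
    (hA : Tendsto A atTop (𝓝 P)) (hB : Tendsto B atTop (𝓝 P))
    {s t : ℕ → ℝ} (hs : ∀ n, 0 ≤ s n) (ht : ∀ n, 0 ≤ t n)
    (hst : ∀ n, s n + t n = (planePt (m n)).1 + (planePt (m n)).2.2)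
    (he : ∀ n, planePt (m n) = s n • A n + t n • B n) : False := by
  have hpm : Tendsto (fun n => planePt (m n)) atTop (𝓝 (planePt w)) :=
    (continuous_planePt.tendsto w).comp hm
  set τ : ℕ → ℝ := fun n => (planePt (m n)).1 + (planePt (m n)).2.2 with hτ
  have hτl : Tendsto τ atTop (𝓝 ((planePt w).1 + (planePt w).2.2)) := by
    have hc : Continuous fun z : ℍ => (planePt z).1 + (planePt z).2.2 :=
      continuous_planePt.fst.add continuous_planePt.snd.snd
    exact (hc.tendsto w).comp hm
  have h0 : Tendsto (fun n => planePt (m n) - τ n • P) atTop (𝓝 0) := by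
    have hA0 : Tendsto (fun n => ‖A n - P‖) atTop (𝓝 0) := by
      simpa using (hA.sub_const P).norm
    have hB0 : Tendsto (fun n => ‖B n - P‖) atTop (𝓝 0) := by
      simpa using (hB.sub_const P).norm
    have hz : Tendsto (fun n => τ n * (‖A n - P‖ + ‖B n - P‖)) atTop (𝓝 0) := by
      simpa using hτl.mul (hA0.add hB0)
    refine squeeze_zero_norm (fun n => ?_) hz
    have e : planePt (m n) - τ n • P = s n • (A n - P) + t n • (B n - P) := by
      rw [he n, hτ]
      simp only
      rw [← hst n, add_smul, smul_sub, smul_sub]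
      abel
    rw [e]
    refine (norm_add_le _ _).trans ?_
    rw [norm_smul, norm_smul, Real.norm_of_nonneg (hs n), Real.norm_of_nonneg (ht n), mul_add]
    have h1 : s n ≤ τ n := by rw [hτ]; simp only; rw [← hst n]; linarith [ht n]
    have h2 : t n ≤ τ n := by rw [hτ]; simp only; rw [← hst n]; linarith [hs n]
    gcongr
  have h1 : planePt w - ((planePt w).1 + (planePt w).2.2) • P = 0 :=
    tendsto_nhds_unique (hpm.sub (hτl.smul_const P)) h0
  have h2 := planePt_det w
  set T := (planePt w).1 + (planePt w).2.2
  rw [sub_eq_zero.mp h1] at h2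
  simp only [Prod.smul_fst, Prod.smul_snd, smul_eq_mul] at h2
  have : (1 : ℝ) = 0 := by linear_combination T ^ 2 * hP - h2
  exact one_ne_zero this

theorem bdryPt_det (a : Boundary) : (bdryPt a).1 * (bdryPt a).2.2 = (bdryPt a).2.1 ^ 2 := by
  simp only [bdryPt]
  ring

/-- Balls of the crossing semi-distance of a filling current are bounded. -/
theorem exists_dist_le_of_measure_crossing_le {Γ : Subgroup PSL(2, ℝ)}
    (hΓ : IsClosedSurfaceGroup Γ) (ν : Measure Geod) [IsLocallyFiniteMeasure ν]
    [SMulInvariantMeasure Γ Geod ν] (hfill : IsFilling ν) (x : ℍ) {r : ℝ≥0∞} (hr : r ≠ ∞) :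
    ∃ R : ℝ, ∀ y : ℍ, ν (crossing x y) ≤ r → dist x y ≤ R := by
  by_contra hcon
  push Not at hcon
  choose y hy hdist using fun n : ℕ => hcon n
  have hyI : Tendsto (fun n => dist I (y n)) atTop atTop := by
    refine tendsto_atTop_mono (fun n => ?_)
      (tendsto_atTop_add_const_right _ (-dist x I) tendsto_natCast_atTop_atTop)
    have := dist_triangle x I (y n)
    linarith [hdist n]
  obtain ⟨φ, b, hφ, hlim⟩ := exists_subseq_tendsto_bdryPt hyI
  obtain ⟨N, k, hk, hN⟩ := exists_lineFwd_eq b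
  have hfin : ν (ahead N (0 : ℕ)) ≠ ∞ := by
    refine ((measure_ahead_le ν hk hN hlim
      (r := ν (crossing (linePt N (0 : ℕ)) x) + r) fun n => ?_).trans_lt
      (ENNReal.add_lt_top.mpr ⟨measure_crossing_lt_top ν _ _, hr.lt_top⟩)).ne
    refine (measure_mono (crossing_subset_union _ x _)).trans ((measure_union_le _ _).trans ?_)
    gcongr
    exact hy _
  have hahead : Tendsto (fun n : ℕ => ν (ahead N n)) atTop (𝓝 0) := by
    have h := tendsto_measure_iInter_atTop (μ := ν) (s := fun n : ℕ => ahead N n)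
      (fun n => (isOpen_form_mul_form_neg _ _).measurableSet.nullMeasurableSet)
      (fun n m h => ahead_antitone N (by exact_mod_cast h)) ⟨0, hfin⟩
    rwa [iInter_ahead, measure_empty] at h
  obtain ⟨R, hR⟩ := hΓ.exists_closedBall
  choose γ hγ using fun n : ℕ => hR (linePt N (2 * (n + 1)))
  set a : ℕ → ℍ := fun n => γ n • linePt N ((n : ℝ) + 1) with ha
  set m : ℕ → ℍ := fun n => γ n • linePt N (2 * ((n : ℝ) + 1)) with hm
  set c : ℕ → ℍ := fun n => γ n • linePt N (3 * ((n : ℝ) + 1)) with hc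
  have hfar : ∀ z : ℕ → ℍ, (∀ n, dist (m n) (z n) = (n : ℝ) + 1) →
      Tendsto (fun n => dist I (z n)) atTop atTop := by
    intro z hz
    refine tendsto_atTop_mono (fun n => ?_)
      (tendsto_atTop_add_const_right _ (-R) tendsto_natCast_atTop_atTop)
    have h1 := dist_triangle (m n) I (z n)
    have h2 : dist (m n) I ≤ R := hγ n
    linarith [hz n]
  have hacr : ∀ n, ν (crossing (a n) (c n)) ≤ ν (ahead N n) := by
    intro n
    rw [ha, hc, measure_crossing_smul]
    exact measure_mono (crossing_linePt_subset_ahead N (by linarith) (by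
      have : (0 : ℝ) ≤ n := n.cast_nonneg
      linarith))
  have hafar : Tendsto (fun n => dist I (a n)) atTop atTop := hfar a fun n => by
    have : (0 : ℝ) ≤ n := n.cast_nonneg
    rw [hm, ha, dist_smul, dist_linePt, abs_of_nonneg] <;> linarith
  have hcfar : Tendsto (fun n => dist I (c n)) atTop atTop := hfar c fun n => by
    have : (0 : ℝ) ≤ n := n.cast_nonneg
    rw [hm, hc, dist_smul, dist_linePt, abs_of_nonpos] <;> linarith
  have hcomb : ∀ n : ℕ, (2 * Real.cosh ((n : ℝ) + 1)) • planePt (m n) =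
      planePt (a n) + planePt (c n) := by
    intro n
    obtain ⟨L, hL⟩ := exists_planePt_smul_linear (γ n : PSL(2, ℝ))
    have h1 : planePt (m n) = L (planePt (linePt N (2 * ((n : ℝ) + 1)))) := hL _
    have h2 : planePt (a n) = L (planePt (linePt N ((n : ℝ) + 1))) := hL _
    have h3 : planePt (c n) = L (planePt (linePt N (3 * ((n : ℝ) + 1)))) := hL _
    rw [h1, h2, h3, ← map_smul, ← map_add, cosh_smul_planePt_linePt]
  obtain ⟨w, -, φ₁, hφ₁, hw⟩ := (isCompact_closedBall I R).tendsto_subseq (x := m) hγ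
  obtain ⟨φ₂, a', hφ₂, ha'⟩ := exists_subseq_tendsto_bdryPt (hafar.comp hφ₁.tendsto_atTop)
  obtain ⟨φ₃, c', hφ₃, hc'⟩ := exists_subseq_tendsto_bdryPt
    (hcfar.comp (hφ₁.comp hφ₂).tendsto_atTop)
  set ψ : ℕ → ℕ := fun n => φ₁ (φ₂ (φ₃ n)) with hψ
  have hψm : StrictMono ψ := (hφ₁.comp hφ₂).comp hφ₃
  have hma : Tendsto (fun n => normPt (a (ψ n))) atTop (𝓝 (bdryPt a')) :=
    ha'.comp hφ₃.tendsto_atTop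
  have hmc : Tendsto (fun n => normPt (c (ψ n))) atTop (𝓝 (bdryPt c')) := hc'
  have hmw : Tendsto (fun n => m (ψ n)) atTop (𝓝 w) := hw.comp (hφ₂.comp hφ₃).tendsto_atTop
  have hne : a' ≠ c' := by
    rintro rfl
    have hcp : ∀ n : ℕ, 0 < 2 * Real.cosh ((n : ℝ) + 1) := fun n => by
      have := Real.cosh_pos ((n : ℝ) + 1)
      positivity
    have hpm : ∀ n, planePt (m n) =
        ((2 * Real.cosh ((n : ℝ) + 1))⁻¹ * ((planePt (a n)).1 + (planePt (a n)).2.2)) •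
          normPt (a n) +
        ((2 * Real.cosh ((n : ℝ) + 1))⁻¹ * ((planePt (c n)).1 + (planePt (c n)).2.2)) •
          normPt (c n) := by
      intro n
      rw [mul_smul, mul_smul, trace_smul_normPt, trace_smul_normPt, ← smul_add, ← hcomb, smul_smul,
        inv_mul_cancel₀ (hcp n).ne', one_smul]
    refine not_bdryPt_eq_of_combination hmw (bdryPt_det a') hma hmc
      (fun n => mul_nonneg (inv_nonneg.mpr (hcp (ψ n)).le) (trace_planePt_pos (a (ψ n))).le)
      (fun n => mul_nonneg (inv_nonneg.mpr (hcp (ψ n)).le) (trace_planePt_pos (c (ψ n))).le)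
      (fun n => ?_) (fun n => hpm (ψ n))
    have h1 := trace_normPt (a (ψ n))
    have h2 := trace_normPt (c (ψ n))
    rw [hpm (ψ n)]
    simp only [Prod.fst_add, Prod.snd_add, Prod.smul_fst, Prod.smul_snd, smul_eq_mul]
    linear_combination
      (-((2 * Real.cosh ((ψ n : ℝ) + 1))⁻¹ *
        ((planePt (a (ψ n))).1 + (planePt (a (ψ n))).2.2))) * h1 -
      ((2 * Real.cosh ((ψ n : ℝ) + 1))⁻¹ *
        ((planePt (c (ψ n))).1 + (planePt (c (ψ n))).2.2)) * h2
  obtain ⟨h, hsupp, htr⟩ := hfill (Geod.mk ⟨(a', c'), hne⟩)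
  obtain ⟨U, hU, hev⟩ := exists_nhds_form_mul_form_neg hma hmc (transverse_mk_iff.mp htr)
  have hUpos : 0 < ν U := (Measure.mem_support_iff_forall h).mp hsupp U hU
  obtain ⟨n, hn1, hn2⟩ := (hev.and
    ((hahead.comp hψm.tendsto_atTop).eventually (gt_mem_nhds hUpos))).exists
  refine absurd (hn2.trans_le ?_) (lt_irrefl (ν (ahead N (ψ n))))
  refine (measure_mono fun g hg => ?_).trans (hacr (ψ n))
  rw [mem_crossing_iff, ← sign_form_normPt, ← sign_form_normPt]
  intro he
  have h2 := sign_neg (hn1 g hg)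
  rw [sign_mul, he] at h2
  revert h2
  generalize SignType.sign (g.form (normPt (c (ψ n)))) = σ
  revert σ
  decide

/-! ### Stable lengths from orbit estimates -/

theorem dist_pow_smul_le {G X : Type*} [Group G] [PseudoMetricSpace X] [MulAction G X]
    [IsIsometricSMul G X] (g : G) (x : X) (k : ℕ) : dist x (g ^ k • x) ≤ k * dist x (g • x) := by
  induction k with
  | zero => simp
  | succ k ih =>
    have h1 := dist_triangle x (g ^ k • x) (g ^ (k + 1) • x)
    rw [pow_succ, mul_smul, dist_smul] at h1
    rw [pow_succ, mul_smul]
    push_cast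
    linarith

theorem hasStableLength_of_orbit_bounds {G X : Type} [Group G] [MetricSpace X] [MulAction G X]
    [IsIsometricSMul G X] (g : G) (x₀ : X) {l c : ℝ} (hlow : ∀ n : ℕ, n * l ≤ dist x₀ (g ^ n • x₀))
    (hup : ∀ n : ℕ, n ≠ 0 → dist x₀ (g ^ n • x₀) ≤ n * l + c) : HasStableLength X g l := by
  have hlow' : ∀ (n : ℕ) (x : X), n * l ≤ dist x (g ^ n • x) := by
    intro n x
    by_contra hcon
    rw [not_le] at hcon
    obtain ⟨k, hk⟩ := exists_nat_gt (2 * dist x₀ x / (n * l - dist x (g ^ n • x)))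
    rw [div_lt_iff₀ (by linarith)] at hk
    have h1 := hlow (n * k)
    have h2 := dist_pow_smul_le (g ^ n) x k
    rw [← pow_mul] at h2
    have h3 := dist_triangle4 x₀ x (g ^ (n * k) • x) (g ^ (n * k) • x₀)
    rw [dist_smul, dist_comm x x₀] at h3
    push_cast at h1
    nlinarith
  have hbdd : ∀ n : ℕ, BddBelow (Set.range fun x : X => dist x (g ^ n • x)) := fun n =>
    ⟨0, by rintro _ ⟨x, rfl⟩; exact dist_nonneg⟩
  have : Nonempty X := ⟨x₀⟩
  have hlim : Tendsto (fun n : ℕ => l + c / n) atTop (𝓝 l) := by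
    simpa using (tendsto_const_div_atTop_nhds_zero_nat c).const_add l
  refine tendsto_of_tendsto_of_tendsto_of_le_of_le' tendsto_const_nhds hlim ?_ ?_
  · filter_upwards [eventually_gt_atTop 0] with n hn
    have hn' : (0 : ℝ) < n := by exact_mod_cast hn
    rw [one_div, ← div_eq_inv_mul, le_div_iff₀ hn', mul_comm]
    exact le_ciInf fun x => hlow' n x
  · filter_upwards [eventually_gt_atTop 0] with n hn
    have hn' : (0 : ℝ) < n := by exact_mod_cast hn
    rw [one_div, ← div_eq_inv_mul, div_le_iff₀ hn', add_mul, div_mul_cancel₀ _ hn'.ne', mul_comm l]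
    exact (ciInf_le (hbdd n) x₀).trans (hup n (Nat.pos_iff_ne_zero.mp hn))

/-! ### Axes and their stabilizers -/

theorem symAct_diagSL (k : ℝ) (hk : k ≠ 0) (X : SymMat) :
    symAct (diagSL k hk) X = (k ^ 2 * X.1, X.2.1, (k ^ 2)⁻¹ * X.2.2) := by
  have e1 : diagSL k hk 0 0 = k := rfl
  have e2 : diagSL k hk 0 1 = 0 := rfl
  have e3 : diagSL k hk 1 0 = 0 := rfl
  have e4 : diagSL k hk 1 1 = k⁻¹ := rfl
  rw [symAct_apply, e1, e2, e3, e4]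
  refine Prod.ext ?_ (Prod.ext ?_ ?_) <;> simp [hk]

theorem smul_linePt {M N : SL(2, ℝ)} {k : ℝ} {hk : k ≠ 0} (h : M * N = N * diagSL k hk) (t : ℝ) :
    (QuotientGroup.mk M : PSL(2, ℝ)) • linePt N t = linePt N (t + Real.log (k ^ 2)) := by
  rw [mk_smul_plane, linePt, ← mul_smul, h, mul_smul, linePt]
  congr 1
  apply planePt_injective
  have hk2 : 0 < k ^ 2 := by positivity
  have ht := Real.exp_pos t
  rw [planePt_smul, symAct_diagSL]
  simp only [planePt, UpperHalfPlane.re, UpperHalfPlane.im, Real.exp_add, Real.exp_log hk2]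
  refine Prod.ext ?_ (Prod.ext ?_ ?_) <;> simp
  field_simp

theorem disc_form_ne_zero (g : Geod) :
    g.form (0, 1, 0) ^ 2 - 4 * (g.form (1, 0, 0) * g.form (0, 0, 1)) ≠ 0 := by
  obtain ⟨p, rfl⟩ := Geod.mk_surjective g
  have hw : wedge (rep p.1.1) (rep p.1.2) ≠ 0 := fun h => p.2 (wedge_rep_eq_zero.mp h)
  have : (Geod.mk p).form (0, 1, 0) ^ 2 -
      4 * ((Geod.mk p).form (1, 0, 0) * (Geod.mk p).form (0, 0, 1)) =
      wedge (rep p.1.1) (rep p.1.2) ^ 2 := by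
    simp only [form_mk, pairForm_apply, wedge]
    ring
  rw [this]
  positivity

theorem diagSL_smul_eq_iff {k : ℝ} {hk : k ≠ 0} (hk1 : 1 < k ^ 2) {g : Geod} :
    (QuotientGroup.mk (diagSL k hk) : PSL(2, ℝ)) • g = g ↔ g = axisGeod := by
  obtain ⟨c, hc, e⟩ := form_smul (diagSL k hk) g
  have s1 : symAct (diagSL k hk) (1, 0, 0) = k ^ 2 • (1, 0, 0) := by
    simp [symAct_diagSL]
  have s2 : symAct (diagSL k hk) (0, 1, 0) = (0, 1, 0) := by
    simp [symAct_diagSL]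
  have s3 : symAct (diagSL k hk) (0, 0, 1) = (k ^ 2)⁻¹ • (0, 0, 1) := by
    simp [symAct_diagSL]
  have e1 := e (1, 0, 0)
  have e2 := e (0, 1, 0)
  have e3 := e (0, 0, 1)
  rw [s1, map_smul, smul_eq_mul] at e1
  rw [s2] at e2
  rw [s3, map_smul, smul_eq_mul] at e3
  have hk0 : k ^ 2 ≠ 0 := by positivity
  constructor
  · intro h
    rw [h] at e1 e2 e3
    have hd := disc_form_ne_zero g
    set l := g.form (1, 0, 0)
    set m := g.form (0, 1, 0)
    set n := g.form (0, 0, 1)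
    have e3' : n = c * k ^ 2 * n := by
      field_simp at e3
      linarith
    by_cases hm : m = 0
    · exfalso
      have hln : l ≠ 0 ∧ n ≠ 0 := by
        refine ⟨fun h0 => hd ?_, fun h0 => hd ?_⟩ <;> rw [h0, hm] <;> ring
      have c1 : k ^ 2 = c := mul_right_cancel₀ hln.1 e1
      have c2 : 1 = c * k ^ 2 := mul_right_cancel₀ hln.2 (by rw [one_mul]; exact e3')
      nlinarith
    · have hc1 : 1 = c := mul_right_cancel₀ hm (by rw [one_mul]; exact e2)
      rw [← hc1, one_mul] at e1 e3'
      refine eq_axisGeod ?_ ?_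
      · have : (k ^ 2 - 1) * l = 0 := by linarith
        exact (mul_eq_zero.mp this).resolve_left (by linarith)
      · have : (k ^ 2 - 1) * n = 0 := by linarith
        exact (mul_eq_zero.mp this).resolve_left (by linarith)
  · rintro rfl
    apply eq_axisGeod
    · rw [form_axisGeod] at e1
      simpa [hk] using e1
    · rw [form_axisGeod] at e3
      simpa [hk] using e3

theorem smul_eq_iff_eq_lineGeod {M N : SL(2, ℝ)} {k : ℝ} {hk : k ≠ 0}
    (h : M * N = N * diagSL k hk) (hk1 : 1 < k ^ 2) {g : Geod} :
    (QuotientGroup.mk M : PSL(2, ℝ)) • g = g ↔ g = lineGeod N := by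
  have h' : (QuotientGroup.mk M : PSL(2, ℝ)) * QuotientGroup.mk N =
      QuotientGroup.mk N * QuotientGroup.mk (diagSL k hk) := by
    rw [← QuotientGroup.mk_mul, h, QuotientGroup.mk_mul]
  rw [lineGeod, ← inv_smul_eq_iff, ← diagSL_smul_eq_iff (hk := hk) hk1, smul_smul,
    eq_comm (b := (QuotientGroup.mk N : PSL(2, ℝ))⁻¹ • g), inv_smul_eq_iff, smul_smul, ← mul_assoc,
    ← h', mul_inv_cancel_right]
  exact eq_comm

theorem exists_eq_linePt {N : SL(2, ℝ)} {z : ℍ} (hz : z ∈ (lineGeod N).carrier) :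
    ∃ u, z = linePt N u := by
  set n : PSL(2, ℝ) := QuotientGroup.mk N with hn
  rw [lineGeod, ← hn, ← smul_inv_smul n z, smul_mem_carrier_smul, mem_carrier_iff,
    form_axisGeod] at hz
  set w := n⁻¹ • z with hw
  have hre : w.re = 0 := by
    simpa [planePt, w.im_ne_zero] using hz
  refine ⟨Real.log w.im, ?_⟩
  rw [← smul_inv_smul n z, ← hw, linePt, hn, mk_smul_plane]
  congr 1
  refine UpperHalfPlane.ext (Complex.ext hre ?_)
  simpa using (Real.exp_log w.im_pos).symm

/-- An element of a surface group that preserves a line translates it. -/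
theorem IsClosedSurfaceGroup.exists_translation {Γ : Subgroup PSL(2, ℝ)}
    (hΓ : IsClosedSurfaceGroup Γ) {N : SL(2, ℝ)} {η : Γ} (hη : η • lineGeod N = lineGeod N) :
    ∃ s : ℝ, ∀ t, η • linePt N t = linePt N (t + s) := by
  obtain ⟨M, hM⟩ := QuotientGroup.mk_surjective (η : PSL(2, ℝ))
  set D : SL(2, ℝ) := N⁻¹ * M * N with hD
  have hMN : M * N = N * D := by rw [hD]; group
  have hDaxis : (QuotientGroup.mk D : PSL(2, ℝ)) • axisGeod = axisGeod := by
    have h1 : (η : PSL(2, ℝ)) • lineGeod N = lineGeod N := hη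
    rw [← hM, lineGeod, smul_smul, ← QuotientGroup.mk_mul, hMN, QuotientGroup.mk_mul, mul_smul] at h1
    exact MulAction.injective _ h1
  obtain ⟨c, hc, e⟩ := form_smul D axisGeod
  have e1 := e (1, 0, 0)
  have e2 := e (0, 0, 1)
  rw [hDaxis, form_axisGeod, form_axisGeod, symAct_apply] at e1 e2
  simp at e1 e2
  have hd := det_eq_one D
  by_cases h00 : D 0 0 = 0
  · have h11 : D 1 1 = 0 := by
      rcases e2 with h | h
      · rw [h00, h] at hd; simp at hd
      · exact h
    obtain ⟨z, hz⟩ := exists_fixed_of_trace_sq_lt (M := D) (by rw [h00, h11]; norm_num)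
    have h1 : η = 1 := by
      refine hΓ.free η (N • z) ?_
      change (η : PSL(2, ℝ)) • (N • z) = N • z
      rw [← hM, mk_smul_plane, ← mul_smul, hMN, mul_smul, hz]
    exact ⟨0, fun t => by rw [h1, one_smul, add_zero]⟩
  · have h10 : D 1 0 = 0 := e1.resolve_left h00
    rw [h10, mul_zero, sub_zero] at hd
    have h11 : D 1 1 = (D 0 0)⁻¹ := eq_inv_of_mul_eq_one_right hd
    have h01 : D 0 1 = 0 := e2.resolve_right (by rw [h11]; exact inv_ne_zero h00)
    have hDd : D = diagSL (D 0 0) h00 := by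
      apply Matrix.SpecialLinearGroup.ext
      intro i j
      fin_cases i <;> fin_cases j
      · rfl
      · exact h01
      · exact h10
      · exact h11
    refine ⟨Real.log (D 0 0 ^ 2), fun t => ?_⟩
    change (η : PSL(2, ℝ)) • linePt N t = _
    rw [← hM]
    exact smul_linePt (hMN.trans (congrArg (N * ·) hDd)) t

theorem translation_pow {Γ : Subgroup PSL(2, ℝ)} {N : SL(2, ℝ)} {η : Γ} {s : ℝ}
    (h : ∀ t, η • linePt N t = linePt N (t + s)) (n : ℕ) (t : ℝ) :
    η ^ n • linePt N t = linePt N (t + n * s) := by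
  induction n generalizing t with
  | zero => simp
  | succ n ih =>
    rw [pow_succ, mul_smul, h, ih]
    push_cast
    ring_nf

theorem translation_inv {Γ : Subgroup PSL(2, ℝ)} {N : SL(2, ℝ)} {η : Γ} {s : ℝ}
    (h : ∀ t, η • linePt N t = linePt N (t + s)) (t : ℝ) :
    η⁻¹ • linePt N t = linePt N (t + -s) := by
  rw [inv_smul_eq_iff, h]
  ring_nf

theorem translation_zpow {Γ : Subgroup PSL(2, ℝ)} {N : SL(2, ℝ)} {η : Γ} {s : ℝ}
    (h : ∀ t, η • linePt N t = linePt N (t + s)) (n : ℤ) (t : ℝ) :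
    η ^ n • linePt N t = linePt N (t + n * s) := by
  rcases Int.eq_nat_or_neg n with ⟨m, rfl | rfl⟩
  · rw [zpow_natCast, translation_pow h]
    simp
  · rw [zpow_neg, zpow_natCast, translation_inv (translation_pow h m)]
    simp

theorem IsClosedSurfaceGroup.eq_of_translation {Γ : Subgroup PSL(2, ℝ)}
    (hΓ : IsClosedSurfaceGroup Γ) {N : SL(2, ℝ)} {η η' : Γ} {s : ℝ}
    (h : ∀ t, η • linePt N t = linePt N (t + s)) (h' : ∀ t, η' • linePt N t = linePt N (t + s)) :
    η = η' := by
  have := hΓ.free (η'⁻¹ * η) (linePt N 0) (by rw [mul_smul, inv_smul_eq_iff, h, h'])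
  exact (inv_mul_eq_one.mp this).symm

/-- The group of translations of a line by elements of `Γ`. -/
def translationGroup (Γ : Subgroup PSL(2, ℝ)) (N : SL(2, ℝ)) : AddSubgroup ℝ where
  carrier := {s | ∃ η : Γ, ∀ t, η • linePt N t = linePt N (t + s)}
  zero_mem' := ⟨1, fun t => by simp⟩
  add_mem' := by
    rintro s s' ⟨η, h⟩ ⟨η', h'⟩
    refine ⟨η * η', fun t => ?_⟩
    rw [mul_smul, h', h]
    ring_nf
  neg_mem' := by
    rintro s ⟨η, h⟩
    exact ⟨η⁻¹, translation_inv h⟩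

/-- The stabilizer of the axis of a primitive element is generated by this element. -/
theorem IsClosedSurfaceGroup.exists_zpow_of_smul_lineGeod {Γ : Subgroup PSL(2, ℝ)}
    (hΓ : IsClosedSurfaceGroup Γ) {N : SL(2, ℝ)} {γ : Γ} (hγ : IsCurve γ) {l : ℝ}
    (hl : ∀ t, γ • linePt N t = linePt N (t + l)) {η : Γ} (hη : η • lineGeod N = lineGeod N) :
    ∃ j : ℤ, η = γ ^ j := by
  obtain ⟨ε, hε, hdisp⟩ := hΓ.exists_le_dist_smul
  have hiso : Disjoint (translationGroup Γ N : Set ℝ) (Set.Ioo 0 ε) := by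
    rw [Set.disjoint_left]
    rintro s ⟨ζ, hζ⟩ ⟨hs0, hsε⟩
    have hne : ζ ≠ 1 := by
      rintro rfl
      have h1 := hζ 0
      rw [one_smul, zero_add] at h1
      have h2 := dist_linePt N 0 s
      rw [← h1, dist_self, zero_sub, abs_neg, abs_of_pos hs0] at h2
      exact hs0.ne h2
    have h1 := hdisp ζ hne (linePt N 0)
    rw [hζ, dist_linePt, zero_add, zero_sub, abs_neg, abs_of_pos hs0] at h1
    linarith
  obtain ⟨s₀, hs₀⟩ := AddSubgroup.cyclic_of_isolated_zero hε hiso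
  rw [← AddSubgroup.zmultiples_eq_closure] at hs₀
  obtain ⟨ζ, hζ⟩ : s₀ ∈ translationGroup Γ N := by
    rw [hs₀]; exact AddSubgroup.mem_zmultiples s₀
  have key : ∀ {ξ : Γ} {s : ℝ}, (∀ t, ξ • linePt N t = linePt N (t + s)) → ∃ j : ℤ, ξ = ζ ^ j := by
    intro ξ s hξ
    have hs : s ∈ translationGroup Γ N := ⟨ξ, hξ⟩
    rw [hs₀, AddSubgroup.mem_zmultiples_iff] at hs
    obtain ⟨j, rfl⟩ := hs
    refine ⟨j, hΓ.eq_of_translation hξ fun t => ?_⟩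
    rw [translation_zpow hζ, zsmul_eq_mul]
  obtain ⟨i, hi⟩ := key hl
  obtain ⟨s, hs⟩ := hΓ.exists_translation hη
  obtain ⟨j, hj⟩ := key hs
  have hi1 : i = 1 ∨ i = -1 := by
    have hi0 : i ≠ 0 := by
      rintro rfl
      exact hγ.1 (by rw [hi, zpow_zero])
    have h1 : ¬ 1 < i := by
      intro h
      refine hγ.2 ζ i.toNat (by omega) ?_
      rw [hi, ← zpow_natCast, Int.toNat_of_nonneg (by omega)]
    have h2 : ¬ i < -1 := by
      intro h
      refine hγ.2 ζ⁻¹ (-i).toNat (by omega) ?_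
      rw [hi, ← zpow_natCast, Int.toNat_of_nonneg (by omega), inv_zpow, zpow_neg, inv_inv]
    omega
  rcases hi1 with rfl | rfl
  · exact ⟨j, by rw [hj, hi, zpow_one]⟩
  · exact ⟨-j, by rw [hj, hi, ← zpow_mul]; simp⟩

/-! ### Geodesics crossing half-open segments of a line -/

/-- The geodesics that cross a line transversely at a time in `[s, t)`. -/
def halfCrossing (N : SL(2, ℝ)) (s t : ℝ) : Set Geod :=
  {h | h ≠ lineGeod N ∧ ∃ u ∈ Set.Ico s t, linePt N u ∈ h.carrier}

theorem halfCrossing_eq (N : SL(2, ℝ)) {s t : ℝ} (hst : s < t) : halfCrossing N s t =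
    crossing (linePt N s) (linePt N t) \ {h : Geod | h.form (planePt (linePt N t)) = 0} := by
  ext h
  rw [Set.mem_sdiff, mem_crossing_linePt hst]
  constructor
  · rintro ⟨hne, u, ⟨h1, h2⟩, hu⟩
    refine ⟨⟨hne, u, ⟨h1, h2.le⟩, hu⟩, fun h0 => ?_⟩
    exact h2.ne (linePt_mem_carrier_unique hne hu (mem_carrier_iff.mpr h0))
  · rintro ⟨⟨hne, u, ⟨h1, h2⟩, hu⟩, h0⟩
    refine ⟨hne, u, ⟨h1, lt_of_le_of_ne h2 ?_⟩, hu⟩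
    rintro rfl
    exact h0 (mem_carrier_iff.mp hu)

theorem measurableSet_halfCrossing (N : SL(2, ℝ)) {s t : ℝ} (hst : s < t) :
    MeasurableSet (halfCrossing N s t) := by
  rw [halfCrossing_eq N hst]
  exact (measurableSet_crossing _ _).diff (isClosed_form_eq_zero _).measurableSet

theorem smul_mem_halfCrossing {Γ : Subgroup PSL(2, ℝ)} {N : SL(2, ℝ)} {η : Γ} {a : ℝ}
    (hη : η • lineGeod N = lineGeod N) (ha : ∀ t, η • linePt N t = linePt N (t + a))
    {s t : ℝ} {h : Geod} : η • h ∈ halfCrossing N (s + a) (t + a) ↔ h ∈ halfCrossing N s t := by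
  refine and_congr (not_congr ?_) ⟨?_, ?_⟩
  · rw [← hη, smul_left_cancel_iff, hη]
  · rintro ⟨u, ⟨h1, h2⟩, hu⟩
    refine ⟨u - a, ⟨by linarith, by linarith⟩, ?_⟩
    rw [← sub_add_cancel u a, ← ha] at hu
    exact smul_mem_carrier_smul.mp hu
  · rintro ⟨u, ⟨h1, h2⟩, hu⟩
    refine ⟨u + a, ⟨by linarith, by linarith⟩, ?_⟩
    rw [← ha]
    exact smul_mem_carrier_smul.mpr hu

theorem measure_halfCrossing_add (ν : Measure Geod) {Γ : Subgroup PSL(2, ℝ)}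
    [SMulInvariantMeasure Γ Geod ν] {N : SL(2, ℝ)} {η : Γ} {a : ℝ}
    (hη : η • lineGeod N = lineGeod N) (ha : ∀ t, η • linePt N t = linePt N (t + a)) (s t : ℝ) :
    ν (halfCrossing N (s + a) (t + a)) = ν (halfCrossing N s t) := by
  rw [← measure_preimage_smul ν η (halfCrossing N (s + a) (t + a))]
  congr 1
  ext h
  exact smul_mem_halfCrossing hη ha

theorem pow_smul_eq {G α : Type*} [Group G] [MulAction G α] {g : G} {x : α} (h : g • x = x)
    (n : ℕ) : g ^ n • x = x := by
  induction n with
  | zero => simp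
  | succ n ih => rw [pow_succ, mul_smul, h, ih]

theorem zpow_smul_eq {G α : Type*} [Group G] [MulAction G α] {g : G} {x : α} (h : g • x = x)
    (n : ℤ) : g ^ n • x = x := by
  rcases Int.eq_nat_or_neg n with ⟨m, rfl | rfl⟩
  · rw [zpow_natCast, pow_smul_eq h]
  · rw [zpow_neg, zpow_natCast, inv_smul_eq_iff, pow_smul_eq h]

theorem measure_halfCrossing_mul (ν : Measure Geod) {Γ : Subgroup PSL(2, ℝ)}
    [SMulInvariantMeasure Γ Geod ν] {N : SL(2, ℝ)} {γ : Γ} {l : ℝ} (hl0 : 0 < l)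
    (hγ : γ • lineGeod N = lineGeod N) (hl : ∀ t, γ • linePt N t = linePt N (t + l)) (n : ℕ) :
    ν (halfCrossing N 0 (n * l)) = n * ν (halfCrossing N 0 l) := by
  induction n with
  | zero =>
    have : halfCrossing N 0 ((0 : ℕ) * l) = ∅ := by
      rw [Set.eq_empty_iff_forall_notMem]
      rintro h ⟨-, u, ⟨h1, h2⟩, -⟩
      simp at h2
      linarith
    rw [this]
    simp
  | succ n ih =>
    have hnl : (0 : ℝ) ≤ n * l := by positivity
    have hun : halfCrossing N 0 ((n + 1 : ℕ) * l) =
        halfCrossing N 0 (n * l) ∪ halfCrossing N (n * l) (n * l + l) := by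
      ext h
      constructor
      · rintro ⟨hne, u, ⟨h1, h2⟩, hu⟩
        push_cast at h2
        rcases lt_or_ge u (n * l) with h3 | h3
        · exact Or.inl ⟨hne, u, ⟨h1, h3⟩, hu⟩
        · exact Or.inr ⟨hne, u, ⟨h3, by linarith⟩, hu⟩
      · rintro (⟨hne, u, ⟨h1, h2⟩, hu⟩ | ⟨hne, u, ⟨h1, h2⟩, hu⟩)
        · exact ⟨hne, u, ⟨h1, by push_cast; linarith⟩, hu⟩
        · exact ⟨hne, u, ⟨by linarith, by push_cast; linarith⟩, hu⟩
    have hdisj : Disjoint (halfCrossing N 0 (n * l)) (halfCrossing N (n * l) (n * l + l)) := by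
      rw [Set.disjoint_left]
      rintro h ⟨hne, u, ⟨-, h2⟩, hu⟩ ⟨-, v, ⟨h3, -⟩, hv⟩
      have := linePt_mem_carrier_unique hne hu hv
      linarith
    rw [hun, measure_union hdisj (measurableSet_halfCrossing N (by linarith)), ih]
    have h1 := measure_halfCrossing_add ν (pow_smul_eq hγ n) (translation_pow hl n) 0 l
    rw [zero_add, add_comm l] at h1
    rw [h1]
    push_cast
    ring

theorem measure_through_smul (ν : Measure Geod) {Γ : Subgroup PSL(2, ℝ)}
    [SMulInvariantMeasure Γ Geod ν] (η : Γ) (z : ℍ) :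
    ν {g : Geod | η • z ∈ g.carrier} = ν {g : Geod | z ∈ g.carrier} := by
  rw [← measure_preimage_smul ν η {g : Geod | η • z ∈ g.carrier}]
  congr 1
  ext h
  exact smul_mem_carrier_smul

theorem le_measure_crossing_pow (ν : Measure Geod) {Γ : Subgroup PSL(2, ℝ)}
    [SMulInvariantMeasure Γ Geod ν] {N : SL(2, ℝ)} {γ : Γ} {l : ℝ} (hl0 : 0 < l)
    (hγ : γ • lineGeod N = lineGeod N) (hl : ∀ t, γ • linePt N t = linePt N (t + l)) (n : ℕ) :
    n * ν (halfCrossing N 0 l) ≤ ν (crossing (linePt N 0) (γ ^ n • linePt N 0)) := by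
  rcases Nat.eq_zero_or_pos n with rfl | hn
  · simp
  · rw [← measure_halfCrossing_mul ν hl0 hγ hl, translation_pow hl, zero_add,
      halfCrossing_eq N (by positivity)]
    exact measure_mono Set.sdiff_subset

theorem measure_crossing_pow_le (ν : Measure Geod) {Γ : Subgroup PSL(2, ℝ)}
    [SMulInvariantMeasure Γ Geod ν] {N : SL(2, ℝ)} {γ : Γ} {l : ℝ} (hl0 : 0 < l)
    (hγ : γ • lineGeod N = lineGeod N) (hl : ∀ t, γ • linePt N t = linePt N (t + l)) {n : ℕ}
    (hn : n ≠ 0) : ν (crossing (linePt N 0) (γ ^ n • linePt N 0)) ≤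
      n * ν (halfCrossing N 0 l) + ν {g : Geod | linePt N 0 ∈ g.carrier} := by
  have hn' : 0 < n := Nat.pos_of_ne_zero hn
  rw [← measure_through_smul ν (γ ^ n) (linePt N 0), ← measure_halfCrossing_mul ν hl0 hγ hl,
    translation_pow hl, zero_add, halfCrossing_eq N (by positivity)]
  refine (measure_mono fun g hg => ?_).trans (measure_union_le _ _)
  by_cases h0 : g.form (planePt (linePt N (n * l))) = 0
  · exact Or.inr (mem_carrier_iff.mpr h0)
  · exact Or.inl ⟨hg, h0⟩

/-! ### The intersection number with a curve -/

instance (Γ : Subgroup PSL(2, ℝ)) : ContinuousConstSMul Γ Geod where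
  continuous_const_smul γ := continuous_const_smul (γ : PSL(2, ℝ))

theorem mem_lifts_iff {Γ : Subgroup PSL(2, ℝ)} {γ : Γ} {g₀ : Geod}
    (h₀ : ∀ g : Geod, γ • g = g ↔ g = g₀) {g : Geod} : g ∈ lifts γ ↔ ∃ δ : Γ, g = δ • g₀ := by
  refine exists_congr fun δ => ?_
  rw [mul_smul, mul_smul, smul_eq_iff_eq_inv_smul, h₀, inv_smul_eq_iff]

theorem countable_lifts {Γ : Subgroup PSL(2, ℝ)} [Countable Γ] {γ : Γ} {g₀ : Geod}
    (h₀ : ∀ g : Geod, γ • g = g ↔ g = g₀) : (lifts γ).Countable := by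
  refine (Set.countable_range fun δ : Γ => δ • g₀).mono fun g hg => ?_
  obtain ⟨δ, rfl⟩ := (mem_lifts_iff h₀).mp hg
  exact ⟨δ, rfl⟩

theorem smul_mem_lifts {Γ : Subgroup PSL(2, ℝ)} {γ δ : Γ} {g : Geod} :
    δ • g ∈ lifts γ ↔ g ∈ lifts γ := by
  have h : ∀ (δ : Γ) {g : Geod}, g ∈ lifts γ → δ • g ∈ lifts γ := by
    rintro δ g ⟨ε, hε⟩
    refine ⟨δ * ε, ?_⟩
    rw [smul_smul, show δ * ε * γ * (δ * ε)⁻¹ * δ = δ * (ε * γ * ε⁻¹) by group, mul_smul, hε]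
  exact ⟨fun hg => by simpa using h δ⁻¹ hg, h δ⟩

instance {Γ : Subgroup PSL(2, ℝ)} (γ : Γ) :
    SMulInvariantMeasure Γ Geod (curveCurrent γ) where
  measure_preimage_smul δ s hs := by
    rw [curveCurrent, Measure.restrict_apply hs,
      Measure.restrict_apply (measurable_const_smul δ hs)]
    have : s ∩ lifts γ = (δ • ·) '' ((δ • ·) ⁻¹' s ∩ lifts γ) := by
      ext g
      constructor
      · rintro ⟨h1, h2⟩
        exact ⟨δ⁻¹ • g, ⟨by simpa using h1, smul_mem_lifts.mpr h2⟩, by simp⟩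
      · rintro ⟨g, ⟨h1, h2⟩, rfl⟩
        exact ⟨h1, smul_mem_lifts.mpr h2⟩
    rw [this, Measure.count_injective_image (MulAction.injective δ)]

theorem sFinite_count_restrict {α : Type*} [MeasurableSpace α] [MeasurableSingletonClass α]
    {s : Set α} (hs : s.Countable) : SFinite (Measure.count.restrict s) := by
  have : s = ⋃ x ∈ s, {x} := by simp
  rw [this, Measure.restrict_biUnion hs (fun x _ y _ h => by simpa using h)
    (fun x => measurableSet_singleton x)]
  have := hs.to_subtype
  have : ∀ x : α, IsFiniteMeasure (Measure.count.restrict ({x} : Set α)) := fun x =>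
    ⟨by simp⟩
  infer_instance

theorem smulInvariant_prod_restrict {Γ : Subgroup PSL(2, ℝ)} (μ ν : Measure Geod) [SFinite μ]
    [SFinite ν] [SMulInvariantMeasure Γ Geod μ] [SMulInvariantMeasure Γ Geod ν] :
    SMulInvariantMeasure Γ (Geod × Geod)
      ((μ.prod ν).restrict {p | Transverse p.1 p.2}) where
  measure_preimage_smul δ s hs := by
    have h1 := ((measurePreserving_smul δ μ).prod (measurePreserving_smul δ ν)).restrict_preimage
      isOpen_transverse.measurableSet
    have h2 : Prod.map (fun g : Geod => δ • g) (fun g : Geod => δ • g) ⁻¹'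
        {p : Geod × Geod | Transverse p.1 p.2} = {p | Transverse p.1 p.2} := by
      ext p
      exact transverse_smul
    rw [h2] at h1
    exact h1.measure_preimage hs.nullMeasurableSet

theorem intersection_curveCurrent {Γ : Subgroup PSL(2, ℝ)} (hΓ : IsClosedSurfaceGroup Γ)
    (ν : Measure Geod) [IsLocallyFiniteMeasure ν] [SMulInvariantMeasure Γ Geod ν] {γ : Γ}
    (hγ : IsCurve γ) {N : SL(2, ℝ)} {l : ℝ} (hl0 : 0 < l)
    (hfix : ∀ g : Geod, γ • g = g ↔ g = lineGeod N)
    (hl : ∀ t, γ • linePt N t = linePt N (t + l)) :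
    intersection Γ ν (curveCurrent γ) = ν (halfCrossing N 0 l) := by
  have := hΓ.countable
  have hcount := countable_lifts hfix
  have : SFinite (curveCurrent γ) := sFinite_count_restrict hcount
  have := smulInvariant_prod_restrict (Γ := Γ) ν (curveCurrent γ)
  set D : Set (Geod × Geod) := halfCrossing N 0 l ×ˢ {lineGeod N} with hD
  have hγ₀ : γ • lineGeod N = lineGeod N := (hfix _).mpr rfl
  have hDm : MeasurableSet D :=
    (measurableSet_halfCrossing N hl0).prod (measurableSet_singleton _)
  have hDS : D ⊆ {p | Transverse p.1 p.2} := by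
    rintro ⟨h, g⟩ ⟨⟨hne, u, -, hu⟩, hg⟩
    obtain rfl : g = lineGeod N := hg
    exact ⟨hne, _, hu, linePt_mem_lineGeod N u⟩
  have hfund : IsFundamentalDomain Γ D
      ((ν.prod (curveCurrent γ)).restrict {p | Transverse p.1 p.2}) := by
    refine ⟨hDm.nullMeasurableSet, ?_, ?_⟩
    · have h1 : ∀ᵐ p ∂(ν.prod (curveCurrent γ)), p.2 ∈ lifts γ :=
        Measure.quasiMeasurePreserving_snd.ae
          (ae_restrict_mem hcount.measurableSet)
      filter_upwards [ae_restrict_of_ae h1,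
        ae_restrict_mem isOpen_transverse.measurableSet] with p hp htr
      obtain ⟨h, g⟩ := p
      obtain ⟨δ, rfl⟩ := (mem_lifts_iff hfix).mp hp
      have htr' : Transverse (δ⁻¹ • h) (lineGeod N) := by
        have h2 : Transverse (δ • (δ⁻¹ • h)) (δ • lineGeod N) := by
          rw [smul_inv_smul]; exact htr
        exact transverse_smul.mp h2
      obtain ⟨hne, z, hz1, hz2⟩ := htr'
      obtain ⟨u, rfl⟩ := exists_eq_linePt hz2
      set j : ℤ := ⌊u / l⌋ with hj
      have hj1 : j * l ≤ u := (le_div_iff₀ hl0).mp (Int.floor_le _)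
      have hj2 : u < (j + 1) * l := (div_lt_iff₀ hl0).mp (Int.lt_floor_add_one _)
      refine ⟨γ ^ (-j) * δ⁻¹, ?_, ?_⟩
      · change (γ ^ (-j) * δ⁻¹) • h ∈ halfCrossing N 0 l
        rw [mul_smul]
        have h3 := (smul_mem_halfCrossing (zpow_smul_eq hγ₀ (-j)) (translation_zpow hl (-j))
          (s := j * l) (t := j * l + l) (h := δ⁻¹ • h)).mpr
          ⟨hne, u, ⟨hj1, by linarith⟩, hz1⟩
        push_cast at h3
        convert h3 using 2 <;> ring
      · change (γ ^ (-j) * δ⁻¹) • (δ • lineGeod N) = lineGeod N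
        rw [smul_smul, inv_mul_cancel_right, zpow_smul_eq hγ₀]
    · intro δ₁ δ₂ hne
      refine Disjoint.aedisjoint (Set.disjoint_left.mpr ?_)
      rintro _ ⟨⟨h₁, g₁⟩, ⟨hh₁, hg₁⟩, rfl⟩ ⟨⟨h₂, g₂⟩, ⟨hh₂, hg₂⟩, e⟩
      obtain rfl : g₁ = lineGeod N := hg₁
      obtain rfl : g₂ = lineGeod N := hg₂
      have e1 : δ₂ • h₂ = δ₁ • h₁ := congrArg Prod.fst e
      have e2 : δ₂ • lineGeod N = δ₁ • lineGeod N := congrArg Prod.snd e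
      have e3 : (δ₁⁻¹ * δ₂) • lineGeod N = lineGeod N := by rw [mul_smul, inv_smul_eq_iff, e2]
      have e4 : (δ₁⁻¹ * δ₂) • h₂ = h₁ := by rw [mul_smul, inv_smul_eq_iff, e1]
      obtain ⟨j, hj⟩ := hΓ.exists_zpow_of_smul_lineGeod hγ hl e3
      rw [hj] at e4
      obtain ⟨n₁, u₁, ⟨a₁, b₁⟩, hu₁⟩ := hh₁
      obtain ⟨n₂, u₂, ⟨a₂, b₂⟩, hu₂⟩ := hh₂
      have h5 : linePt N (u₂ + j * l) ∈ h₁.carrier := by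
        rw [← e4, ← translation_zpow hl]
        exact smul_mem_carrier_smul.mpr hu₂
      have h6 := linePt_mem_carrier_unique n₁ hu₁ h5
      have h7 : j = 0 := by
        have h8 : (j : ℝ) * l < 1 * l := by linarith
        have h9 : (-1 : ℝ) * l < j * l := by linarith
        have h10 : (j : ℝ) < 1 := lt_of_mul_lt_mul_right h8 hl0.le
        have h11 : (-1 : ℝ) < j := lt_of_mul_lt_mul_right h9 hl0.le
        have h12 : j < 1 := by exact_mod_cast h10
        have h13 : -1 < j := by exact_mod_cast h11
        omega
      rw [h7, zpow_zero] at hj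
      exact hne (inv_mul_eq_one.mp hj)
  rw [intersection, hfund.covolume_eq_volume, Measure.restrict_apply hDm,
    Set.inter_eq_left.mpr hDS, hD, Measure.prod_prod, curveCurrent,
    Measure.restrict_apply (measurableSet_singleton _), Set.inter_eq_left.mpr, Measure.count_singleton,
    mul_one]
  rw [Set.singleton_subset_iff, mem_lifts_iff hfix]
  exact ⟨1, (one_smul _ _).symm⟩

/-- The axis of a nontrivial element of a surface group. -/
theorem IsClosedSurfaceGroup.exists_axis {Γ : Subgroup PSL(2, ℝ)} (hΓ : IsClosedSurfaceGroup Γ)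
    {γ : Γ} (hγ : γ ≠ 1) : ∃ (N : SL(2, ℝ)) (l : ℝ), 0 < l ∧
      (∀ g : Geod, γ • g = g ↔ g = lineGeod N) ∧ ∀ t, γ • linePt N t = linePt N (t + l) := by
  obtain ⟨γ, hmem⟩ := γ
  obtain ⟨M, rfl⟩ := QuotientGroup.mk_surjective γ
  have h1 : (QuotientGroup.mk M : PSL(2, ℝ)) ≠ 1 := fun h => hγ (Subtype.ext h)
  obtain ⟨N, k, hk, hk1, e⟩ := exists_diagonalization (hΓ.four_lt_trace_sq hmem h1)
  exact ⟨N, Real.log (k ^ 2), Real.log_pos hk1, fun g => smul_eq_iff_eq_lineGeod e hk1,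
    fun t => smul_linePt e t⟩

/-! ### The action on the dual space -/

theorem actsDiscretely_dualSpace {Γ : Subgroup PSL(2, ℝ)}
    (hΓ : IsClosedSurfaceGroup Γ) (ν : Measure Geod) [IsLocallyFiniteMeasure ν]
    [SMulInvariantMeasure Γ Geod ν] (hfill : IsFilling ν) : ActsDiscretely Γ (DualSpace ν) := by
  intro x r
  obtain ⟨y, hy⟩ := (denseRange_dualProj ν).exists_dist_lt x one_pos
  obtain ⟨R, hR⟩ := exists_dist_le_of_measure_crossing_le hΓ ν hfill y
    (r := ENNReal.ofReal (r + 2)) ENNReal.ofReal_ne_top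
  refine (hΓ.finite_dist_le y y R).subset fun γ hγ => hR _ ?_
  have hγ' : dist x (γ • x) ≤ r := hγ
  rw [← edist_dualProj, edist_dist]
  refine ENNReal.ofReal_le_ofReal ?_
  rw [dualProj_smul]
  have h1 := dist_triangle4 (dualProj ν y) x (γ • x) (γ • dualProj ν y)
  rw [dist_smul, dist_comm (dualProj ν y) x] at h1
  linarith

theorem actsCocompactly_dualSpace {Γ : Subgroup PSL(2, ℝ)}
    (hΓ : IsClosedSurfaceGroup Γ) (ν : Measure Geod) [IsLocallyFiniteMeasure ν]
    [SMulInvariantMeasure Γ Geod ν] (hfill : IsFilling ν) : ActsCocompactly Γ (DualSpace ν) := by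
  obtain ⟨R, hR⟩ := hΓ.exists_closedBall
  have hK := isCompact_closure_dualProj_image ν (isCompact_closedBall I R)
  refine ⟨_, hK, fun x => ?_⟩
  have happ : ∀ n : ℕ, ∃ γ : Γ, ∃ k ∈ Metric.closedBall I R,
      dist (γ • x) (dualProj ν k) < 1 / ((n : ℝ) + 1) := by
    intro n
    obtain ⟨y, hy⟩ := (denseRange_dualProj ν).exists_dist_lt x
      (Nat.one_div_pos_of_nat (α := ℝ) (n := n))
    obtain ⟨γ, hγ⟩ := hR y
    refine ⟨γ, _, hγ, ?_⟩
    rwa [dualProj_smul, dist_smul]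
  choose γ k hk hd using happ
  obtain ⟨C, hC⟩ := hK.isBounded.subset_closedBall x
  have hfin : (Set.range γ).Finite := by
    refine (actsDiscretely_dualSpace hΓ ν hfill x (C + 1)).subset ?_
    rintro _ ⟨n, rfl⟩
    have h1 : dist (dualProj ν (k n)) x ≤ C := hC (subset_closure ⟨_, hk n, rfl⟩)
    have h2 : 1 / ((n : ℝ) + 1) ≤ 1 := by
      rw [div_le_one (by positivity)]
      have : (0 : ℝ) ≤ n := n.cast_nonneg
      linarith
    have h3 := dist_triangle_right x (γ n • x) (dualProj ν (k n))
    rw [dist_comm x (dualProj ν (k n))] at h3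
    exact (h3.trans (add_le_add h1 ((hd n).le.trans h2)))
  have := hfin.to_subtype
  obtain ⟨⟨δ, hδ⟩, hinf⟩ := Finite.exists_infinite_fiber (Set.rangeFactorization γ)
  have hinf' : {n | γ n = δ}.Infinite := by
    refine (Set.infinite_coe_iff.mp hinf).mono fun n hn => ?_
    exact congrArg Subtype.val hn
  refine ⟨δ, ?_⟩
  rw [← closure_closure, Metric.mem_closure_iff]
  intro ε hε
  obtain ⟨m, hm⟩ := exists_nat_one_div_lt hε
  obtain ⟨n, hn, hmn⟩ := hinf'.exists_gt m
  refine ⟨_, subset_closure ⟨k n, hk n, rfl⟩, ?_⟩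
  have h1 := hd n
  rw [show γ n = δ from hn] at h1
  refine h1.trans (lt_of_le_of_lt ?_ hm)
  gcongr

theorem exists_hasStableLength {Γ : Subgroup PSL(2, ℝ)} (hΓ : IsClosedSurfaceGroup Γ)
    (ν : Measure Geod) [IsLocallyFiniteMeasure ν] [SMulInvariantMeasure Γ Geod ν] {γ : Γ}
    (hγ : IsCurve γ) : intersection Γ ν (curveCurrent γ) ≠ ∞ ∧
      HasStableLength (DualSpace ν) γ (intersection Γ ν (curveCurrent γ)).toReal := by
  obtain ⟨N, l, hl0, hfix, hl⟩ := hΓ.exists_axis hγ.1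
  have hγ₀ : γ • lineGeod N = lineGeod N := (hfix _).mpr rfl
  rw [intersection_curveCurrent hΓ ν hγ hl0 hfix hl]
  have hI : ν (halfCrossing N 0 l) ≠ ∞ := by
    rw [halfCrossing_eq N hl0]
    exact ((measure_mono Set.sdiff_subset).trans_lt (measure_crossing_lt_top ν _ _)).ne
  have hC : ν {g : Geod | linePt N 0 ∈ g.carrier} ≠ ∞ := by
    have := measure_meets_lt_top ν (isCompact_singleton (x := linePt N 0))
    simpa using this.ne
  refine ⟨hI, hasStableLength_of_orbit_bounds γ (dualProj ν (linePt N 0))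
    (c := (ν {g : Geod | linePt N 0 ∈ g.carrier}).toReal) (fun n => ?_) fun n hn => ?_⟩
  · rw [← dualProj_smul, dist_dualProj]
    have h := ENNReal.toReal_mono (measure_crossing_lt_top ν _ _).ne
      (le_measure_crossing_pow ν hl0 hγ₀ hl n)
    rwa [ENNReal.toReal_mul, ENNReal.toReal_natCast] at h
  · rw [← dualProj_smul, dist_dualProj]
    have hnI : (n : ℝ≥0∞) * ν (halfCrossing N 0 l) ≠ ∞ :=
      ENNReal.mul_ne_top (ENNReal.natCast_ne_top n) hI
    have h := ENNReal.toReal_mono (ENNReal.add_ne_top.mpr ⟨hnI, hC⟩)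
      (measure_crossing_pow_le ν hl0 hγ₀ hl hn)
    rwa [ENNReal.toReal_add hnI hC, ENNReal.toReal_mul, ENNReal.toReal_natCast] at h

end Currents

end

open Currents in
theorem mainTheorem4 (Γ : Subgroup PSL(2, ℝ)) (hΓ : IsClosedSurfaceGroup Γ)
    (ν : Measure Geod) (hν : IsCurrent Γ ν) (hfill : IsFilling ν) :
    ∃ (X : Type) (_ : MetricSpace X) (_ : MulAction Γ X),
      IsIsometricSMul Γ X ∧ ActsDiscretely Γ X ∧ ActsCocompactly Γ X ∧
      (∃ π : ℍ → X, DenseRange π ∧ (∀ (γ : Γ) (x : ℍ), π (γ • x) = γ • π x) ∧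
        ∀ x y : ℍ, edist (π x) (π y) = ν (crossing x y)) ∧
      ∀ γ : Γ, IsCurve γ →
        intersection Γ ν (curveCurrent γ) ≠ ∞ ∧
        HasStableLength X γ (intersection Γ ν (curveCurrent γ)).toReal := by
  have := hν.locallyFinite
  have := hν.invariant
  exact ⟨DualSpace ν, inferInstance, inferInstance, inferInstance,
    actsDiscretely_dualSpace hΓ ν hfill, actsCocompactly_dualSpace hΓ ν hfill,
    ⟨dualProj ν, denseRange_dualProj ν, dualProj_smul ν Γ, edist_dualProj ν⟩,
    fun _ hγ => exists_hasStableLength hΓ ν hγ⟩
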